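/- Let $\alpha>0$, $u_0>0$, $u_\pm\in\mathbb C$ with $|u_\pm|=u_0$, and let $u:\mathbb R\times\mathbb R\to\mathbb C$ (in the application, a solution of the modified NLS equation $iu_t+u_{xx}+4i\alpha u_x+\frac{i}{\alpha}(|u|^2u)_x=0$) be such that for every $t$ the function $u(\cdot,t)$ is differentiable, $u(x,t)\to u_\pm$ as $x\to\pm\infty$, $u(\cdot,t)-u_-\in L^1(-\infty,0)$, $u(\cdot,t)-u_+\in L^1(0,\infty)$ and $u_x(\cdot,t)\in L^1(\mathbb R)$. Put $$\sigma_3=\begin{pmatrix}1&0\\0&-1\end{pmatrix},\quad Q=\begin{pmatrix}0&u\\ \bar u&0\end{pmatrix},\quad Q_\pm=\begin{pmatrix}0&u_\pm\\ \bar u_\pm&0\end{pmatrix},\quad k=\frac{1}{2\alpha}\Big(z-\frac{u_0^2}{z}\Big),\quad \lambda=\frac12\Big(z+\frac{u_0^2}{z}\Big),$$ $$X=-i\alpha k^2\sigma_3+ikQ,\qquad Y_\pm=I+\frac1z\sigma_3Q_\pm,\qquad \theta=-k\lambda\Big[x+\Big(2\alpha k^2-4\alpha-\frac{u_0^2}{\alpha}\Big)t\Big].$$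 The Jost solutions $\phi_\pm(x,t,z)$ are the solutions of the spatial equation $\phi_x=X\phi$ of the Lax pair normalized by $\varphi_\pm:=\phi_\pm e^{-i\theta\sigma_3}\to Y_\pm$ as $x\to\pm\infty$. They are considered column by column, for $z\in\mathbb C\setminus\{0,\pm iu_0\}$: the first column of $\phi_-$ and the second column of $\phi_+$ for $\operatorname{Re}z\operatorname{Im}z\ge 0$, the second column of $\phi_-$ and the first column of $\phi_+$ for $\operatorname{Re}z\operatorname{Im}z\le 0$ (so both columns on the real and imaginary axes). Then these columns exist and are unique for every $t$ and every such $z$; the function $u_0^2-|u(\cdot,t)|^2$ is integrable on every half-line; and with $$\nu_\pm(x,t)=\frac{1}{2\alpha}\int_{\pm\infty}^x\big(u_0^2-|u(y,t)|^2\big)\,dy$$ one has, for all fixed $x,t$ and with every column taken as $z$ tends to its limit within the region of that column, $$\varphi_\pm(x,t,z)=e^{i\nu_\pm(x,t)\sigma_3}+O(z^{-1})\quad(z\to\infty),\qquad \varphi_\pm(x,t,z)=\frac1z e^{i\nu_\pm(x,t)\sigma_3}\sigma_3Q_\pm+O(1)\quad(z\to0),$$ $$u(x,t)=\lim_{z\to\infty}\big(e^{i\nu_\pm(x,t)\sigma_3}\,z\,\varphi_\pm(x,t,z)\big)_{12}.$$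 -/

import Mathlib

open Filter Topology MeasureTheory Asymptotics
open scoped Matrix

noncomputable section

namespace MNLS

/-- The two spatial ends: `minus` is `x → -∞`, `plus` is `x → +∞`. -/
inductive Side : Type
  | minus : Side
  | plus : Side

/-- The filter on the line belonging to an end. -/
def Side.atEnd : Side → Filter ℝ
  | Side.minus => atBot
  | Side.plus => atTop

/-- A closed half-line reaching the given end. -/
def Side.halfLine : Side → Set ℝ
  | Side.minus => Set.Iic 0
  | Side.plus => Set.Ici 0

/-- The Pauli matrix `σ₃ = diag(1, -1)`. -/
def sigma3 : Matrix (Fin 2) (Fin 2) ℂ := !![1, 0; 0, -1]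

/-- `e^{i a σ₃} = diag(e^{i a}, e^{-i a})`. -/
def expISigma3 (a : ℂ) : Matrix (Fin 2) (Fin 2) ℂ :=
  !![Complex.exp (Complex.I * a), 0; 0, Complex.exp (-(Complex.I * a))]

/-- The potential matrix `Q` with upper right entry `v` and lower left entry `v*`. -/
def potQ (v : ℂ) : Matrix (Fin 2) (Fin 2) ℂ := !![0, v; (starRingEnd ℂ) v, 0]

/-- The spectral parameter `k(z) = (z - u₀²/z) / (2α)`. -/
def specK (α u₀ : ℝ) (z : ℂ) : ℂ := (z - (u₀ : ℂ) ^ 2 / z) / (2 * (α : ℂ))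

/-- The eigenvalue parameter `λ(z) = (z + u₀²/z) / 2`. -/
def specLam (u₀ : ℝ) (z : ℂ) : ℂ := (z + (u₀ : ℂ) ^ 2 / z) / 2

/-- The coefficient `X = -iαk²σ₃ + ikQ` of the spatial part `φ_x = X φ` of the Lax pair, at a
point where the potential has the value `v`. -/
def laxX (α u₀ : ℝ) (v z : ℂ) : Matrix (Fin 2) (Fin 2) ℂ :=
  (-(Complex.I * (α : ℂ) * specK α u₀ z ^ 2)) • sigma3 + (Complex.I * specK α u₀ z) • potQ v

/-- The eigenvector matrix `Y_± = I + z⁻¹ σ₃ Q_±`, where `v = u_±`. -/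
def eigY (v z : ℂ) : Matrix (Fin 2) (Fin 2) ℂ := 1 + z⁻¹ • (sigma3 * potQ v)

/-- The phase `θ = -kλ [x + (2αk² - 4α - u₀²/α) t]`. -/
def phase (α u₀ x t : ℝ) (z : ℂ) : ℂ :=
  -(specK α u₀ z * specLam u₀ z *
    ((x : ℂ) + (2 * (α : ℂ) * specK α u₀ z ^ 2 - 4 * (α : ℂ) - (u₀ : ℂ) ^ 2 / (α : ℂ)) * (t : ℂ)))

/-- The closed region on which column `j` of the Jost solution at the given end is defined:
the first column at `-∞` and the second column at `+∞` on `Re z Im z ≥ 0`, the other two on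
`Re z Im z ≤ 0`; the points `0` and `± i u₀` are removed. -/
def jostDomain (u₀ : ℝ) : Side → Fin 2 → Set ℂ
  | Side.minus, 0 => {z | z ≠ 0 ∧ z ^ 2 ≠ -(u₀ : ℂ) ^ 2 ∧ 0 ≤ z.re * z.im}
  | Side.minus, 1 => {z | z ≠ 0 ∧ z ^ 2 ≠ -(u₀ : ℂ) ^ 2 ∧ z.re * z.im ≤ 0}
  | Side.plus, 0 => {z | z ≠ 0 ∧ z ^ 2 ≠ -(u₀ : ℂ) ^ 2 ∧ z.re * z.im ≤ 0}
  | Side.plus, 1 => {z | z ≠ 0 ∧ z ^ 2 ≠ -(u₀ : ℂ) ^ 2 ∧ 0 ≤ z.re * z.im}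

/-- `f` is, as a function of `x` at the fixed time `t`, column `j` of the Jost solution at the end
`s`: it solves `f_x = X f` on the whole line, and after multiplication by the `j`-th diagonal entry
of `e^{-iθσ₃}` it tends to column `j` of `Y_±` at that end. -/
structure IsJostColumn (α u₀ : ℝ) (uInf : Side → ℂ) (u : ℝ → ℝ → ℂ) (s : Side) (t : ℝ) (z : ℂ)
    (j : Fin 2) (f : ℝ → Fin 2 → ℂ) : Prop where
  lax : ∀ x : ℝ, HasDerivAt f (laxX α u₀ (u x t) z *ᵥ f x) x
  normalized : Tendsto (fun x : ℝ => expISigma3 (-phase α u₀ x t z) j j • f x) s.atEnd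
    (𝓝 ((eigY (uInf s) z).col j))

/-- `φ` is the matrix Jost solution at the end `s`: each of its columns is the Jost column, at all
times and all `z` in the region belonging to that column. -/
def IsJost (α u₀ : ℝ) (uInf : Side → ℂ) (u : ℝ → ℝ → ℂ) (s : Side)
    (φ : ℝ → ℝ → ℂ → Matrix (Fin 2) (Fin 2) ℂ) : Prop :=
  ∀ (j : Fin 2) (t : ℝ), ∀ z ∈ jostDomain u₀ s j,
    IsJostColumn α u₀ uInf u s t z j (fun x => (φ x t z).col j)

/-- The modified Jost solution `φ e^{-iθσ₃}`. -/
def modifiedJost (α u₀ : ℝ) (φ : ℝ → ℝ → ℂ → Matrix (Fin 2) (Fin 2) ℂ) (x t : ℝ) (z : ℂ) :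
    Matrix (Fin 2) (Fin 2) ℂ :=
  φ x t z * expISigma3 (-phase α u₀ x t z)

/-- `ν_±(x,t) = (1/2α) ∫_{±∞}^x (u₀² - |u(y,t)|²) dy`. -/
def nu (α u₀ : ℝ) (u : ℝ → ℝ → ℂ) : Side → ℝ → ℝ → ℝ
  | Side.minus, x, t => 1 / (2 * α) * ∫ y in Set.Iic x, (u₀ ^ 2 - ‖u y t‖ ^ 2)
  | Side.plus, x, t => 1 / (2 * α) * -∫ y in Set.Ici x, (u₀ ^ 2 - ‖u y t‖ ^ 2)

end MNLS

end

/-! A reflection of the line, a permutation of the components and multiplication by `e^{-iθσ₃}`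
bring the equations of all four Jost columns to the single form
`w' = κ₀ (z - c / z) (c / z, U; V, z) w`, `c = u₀²`, to be solved from `x = -∞`. At `-∞` the
coefficient matrix has determinant `0`, hence is its trace times a projection; on the region of the
column the propagator of the limit system is therefore bounded, and a Volterra equation with
integrable kernel gives existence and uniqueness.

As `z → ∞`, the diagonal terms that do not decay are `κ₀ (c - U V)` and its negative, and
the gauge `exp (∓ κ₀ ∫_{-∞}^x (c - U V))` removes them; its value is the factor `e^{iνσ₃}`. What
remains is the off-diagonal system `a' = q b`, `b' = μ b + r a` with `Re μ ≤ 0` and `|μ| ~ |z|²`,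
where `b = z w₂ + V w₁` up to the gauge. One integration by parts in `∫ q b` gains the factor `1/μ`,
so `a = 1 + O(z⁻²)`, while `b → 0` by a Riemann–Lebesgue argument, which is the recovery formula.

The map `z ↦ -u₀²/z` fixes `k` and reverses `λ`, hence interchanges the two columns at each end up
to an off-diagonal entry of `Y_±`; this turns the expansion at `∞` into the one at `0`. -/

noncomputable section

namespace MNLS

section HalfLine

variable {E : Type*} [NormedAddCommGroup E]

theorem exists_forall_le_norm_le_of_tendsto_atBot {f : ℝ → E} (hf : Continuous f) {l : E}
    (hl : Tendsto f atBot (𝓝 l)) (X : ℝ) : ∃ C, ∀ x ≤ X, ‖f x‖ ≤ C := by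
  have near_end : ∀ᶠ x in atBot, ‖f x‖ ≤ ‖l‖ + 1 :=
    (hl.norm.eventually (gt_mem_nhds (lt_add_one _))).mono fun _ hx => hx.le
  obtain ⟨a, ha⟩ := eventually_atBot.1 near_end
  obtain ⟨D, hD⟩ := (isCompact_Icc (a := a) (b := X)).exists_bound_of_continuousOn hf.continuousOn
  refine ⟨max (‖l‖ + 1) D, fun x hx => ?_⟩
  rcases le_total x a with h | h
  · exact (ha x h).trans (le_max_left _ _)
  · exact (hD x ⟨h, hx⟩).trans (le_max_right _ _)

theorem setIntegral_Iic_mono {m : ℝ → ℝ} (hm : ∀ x, 0 ≤ m x)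
    (hi : ∀ x, IntegrableOn m (Set.Iic x)) : Monotone fun x => ∫ y in Set.Iic x, m y :=
  fun _ y hxy => setIntegral_mono_set (hi y) (Eventually.of_forall hm)
    (Set.Iic_subset_Iic.2 hxy).eventuallyLE

variable [NormedSpace ℝ E] [CompleteSpace E]

theorem hasDerivAt_setIntegral_Iic {f : ℝ → E} (hf : Continuous f)
    (hi : ∀ x, IntegrableOn f (Set.Iic x)) (x : ℝ) :
    HasDerivAt (fun x => ∫ y in Set.Iic x, f y) (f x) x := by
  have split_at_zero : (fun x => ∫ y in Set.Iic x, f y)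
      = fun x => (∫ y in Set.Iic (0 : ℝ), f y) + ∫ y in (0 : ℝ)..x, f y := by
    funext x
    rw [← intervalIntegral.integral_Iic_sub_Iic (hi 0) (hi x), add_sub_cancel]
  rw [split_at_zero]
  exact (hf.integral_hasStrictDerivAt 0 x).hasDerivAt.const_add _

theorem continuous_setIntegral_Iic {f : ℝ → E} (hf : Continuous f)
    (hi : ∀ x, IntegrableOn f (Set.Iic x)) : Continuous fun x => ∫ y in Set.Iic x, f y :=
  continuous_iff_continuousAt.2 fun x => (hasDerivAt_setIntegral_Iic hf hi x).continuousAt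

section Weight

variable {m : ℝ → ℝ} (hm : Continuous m) (hm₀ : ∀ x, 0 ≤ m x)
  (hi : ∀ x, IntegrableOn m (Set.Iic x))

include hm hm₀ hi

theorem integrableOn_Iic_mul_exp_setIntegral {L : ℝ} (hL : 0 ≤ L) (x : ℝ) :
    IntegrableOn (fun y => m y * Real.exp (L * ∫ s in Set.Iic y, m s)) (Set.Iic x) := by
  have hB := continuous_setIntegral_Iic hm hi
  refine (hi x).mul_bdd (c := Real.exp (L * ∫ s in Set.Iic x, m s))
    (Continuous.aestronglyMeasurable (by fun_prop)) ?_
  refine ae_restrict_of_forall_mem measurableSet_Iic fun y hy => ?_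
  rw [Real.norm_of_nonneg (Real.exp_pos _).le]
  exact Real.exp_le_exp.2 (mul_le_mul_of_nonneg_left (setIntegral_Iic_mono hm₀ hi hy) hL)

theorem setIntegral_Iic_mul_exp_setIntegral {L : ℝ} (hL : 0 < L) (x : ℝ) :
    ∫ y in Set.Iic x, m y * Real.exp (L * ∫ s in Set.Iic y, m s)
      = (Real.exp (L * ∫ s in Set.Iic x, m s) - 1) / L := by
  have primitive : ∀ y ∈ Set.Iic x, HasDerivAt (fun y => Real.exp (L * ∫ s in Set.Iic y, m s) / L)
      (m y * Real.exp (L * ∫ s in Set.Iic y, m s)) y := fun y _ =>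
    (((hasDerivAt_setIntegral_Iic hm hi y).const_mul L).exp.div_const L).congr_deriv
      (by field_simp)
  have limit : Tendsto (fun y => Real.exp (L * ∫ s in Set.Iic y, m s) / L) atBot
      (𝓝 (Real.exp (L * 0) / L)) :=
    ((tendsto_integral_Iic_zero tendsto_id).const_mul L).rexp.div_const L
  rw [integral_Iic_of_hasDerivAt_of_tendsto' primitive
    (integrableOn_Iic_mul_exp_setIntegral hm hm₀ hi hL.le x) limit, mul_zero, Real.exp_zero,
    sub_div]

-- The function `(a + ∫ m g) e^{-∫ m}` is antitone and tends to `a` at `-∞`.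
theorem le_mul_exp_of_le_add_setIntegral_Iic {g : ℝ → ℝ} (hg : Continuous g)
    (hmg : ∀ x, IntegrableOn (fun y => m y * g y) (Set.Iic x)) {a : ℝ}
    (hle : ∀ x, g x ≤ a + ∫ y in Set.Iic x, m y * g y) (x : ℝ) :
    g x ≤ a * Real.exp (∫ y in Set.Iic x, m y) := by
  set B : ℝ → ℝ := fun x => ∫ y in Set.Iic x, m y
  set G : ℝ → ℝ := fun x => a + ∫ y in Set.Iic x, m y * g y
  have hB : ∀ y, HasDerivAt B (m y) y := hasDerivAt_setIntegral_Iic hm hi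
  have hG : ∀ y, HasDerivAt G (m y * g y) y := fun y =>
    (hasDerivAt_setIntegral_Iic (f := fun y => m y * g y) (by fun_prop) hmg y).const_add a
  have hderiv : ∀ y, HasDerivAt (fun y => G y * Real.exp (-B y))
      (m y * (g y - G y) * Real.exp (-B y)) y := fun y =>
    ((hG y).fun_mul (hB y).fun_neg.exp).congr_deriv (by ring)
  have hanti : Antitone fun y => G y * Real.exp (-B y) :=
    antitone_of_deriv_nonpos (fun y => (hderiv y).differentiableAt) fun y => by
      rw [(hderiv y).deriv]
      exact mul_nonpos_of_nonpos_of_nonneg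
        (mul_nonpos_of_nonneg_of_nonpos (hm₀ y) (sub_nonpos.2 (hle y))) (Real.exp_pos _).le
  have hlim : Tendsto (fun y => G y * Real.exp (-B y)) atBot (𝓝 ((a + 0) * Real.exp (-0))) :=
    ((tendsto_integral_Iic_zero tendsto_id).const_add a).mul
      (tendsto_integral_Iic_zero tendsto_id).neg.rexp
  have hGx : G x * Real.exp (-B x) ≤ a := by
    simpa only [neg_zero, Real.exp_zero, mul_one, add_zero] using hanti.ge_of_tendsto hlim x
  rw [Real.exp_neg, ← div_eq_mul_inv, div_le_iff₀ (Real.exp_pos _)] at hGx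
  exact (hle x).trans hGx

end Weight

end HalfLine

section Volterra

open NormedSpace (exp)

theorem exp_smul_of_isIdempotentElem {𝔸 : Type*} [NormedRing 𝔸] [NormedAlgebra ℂ 𝔸]
    [CompleteSpace 𝔸] {R : 𝔸} (hR : IsIdempotentElem R) (a : ℂ) :
    exp (a • R) = 1 - R + Complex.exp a • R := by
  let _ : NormedAlgebra ℚ 𝔸 := .restrictScalars ℚ ℂ 𝔸
  have scalar_series : HasSum (fun n : ℕ => ((n.factorial : ℂ)⁻¹ • a ^ n) • R)
      (Complex.exp a • R) := by
    rw [Complex.exp_eq_exp_ℂ]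
    exact (NormedSpace.exp_series_hasSum_exp' (𝕂 := ℂ) a).smul_const R
  have first_term : HasSum (fun n : ℕ => if n = 0 then 1 - R else 0) (1 - R) := hasSum_ite_eq 0 _
  refine (NormedSpace.exp_series_hasSum_exp' (𝕂 := ℂ) (a • R)).unique ?_
  convert first_term.add scalar_series using 2 with n
  rcases Nat.eq_zero_or_pos n with rfl | hn
  · simp only [Nat.factorial_zero, Nat.cast_one, inv_one, pow_zero, one_smul, if_true,
      sub_add_cancel]
  · rw [if_neg hn.ne', zero_add, smul_pow, hR.pow_eq hn.ne', smul_assoc]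

variable {E : Type*} [NormedAddCommGroup E] [NormedSpace ℂ E]

theorem exp_smul_apply_comm (A : E →L[ℂ] E) (s : ℝ) (v : E) :
    exp (s • A) (A v) = A (exp (s • A) v) :=
  congrArg (fun T : E →L[ℂ] E => T v) ((Commute.refl A).smul_left s).exp_left

/-- The semigroup `e^{sA}`, `s ≥ 0`, is bounded by `C`: the condition under which the equation
`w' = A w + F` can be solved from `-∞`. -/
def IsForwardBounded (A : E →L[ℂ] E) (C : ℝ) : Prop :=
  ∀ s : ℝ, 0 ≤ s → ‖exp (s • A)‖ ≤ C

/-- The solution of `w' = A w + F` that vanishes at `-∞`. -/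
def duhamel (A : E →L[ℂ] E) (F : ℝ → E) (x : ℝ) : E :=
  ∫ y in Set.Iic x, exp ((x - y) • A) (F y)

variable {A : E →L[ℂ] E} {C : ℝ}

theorem IsForwardBounded.nonneg (hA : IsForwardBounded A C) : 0 ≤ C :=
  (norm_nonneg _).trans (hA 0 le_rfl)

theorem IsForwardBounded.norm_duhamel_le (hA : IsForwardBounded A C) {F : ℝ → E} {x : ℝ}
    (hF : IntegrableOn F (Set.Iic x)) :
    ‖duhamel A F x‖ ≤ C * ∫ y in Set.Iic x, ‖F y‖ := by
  rw [← integral_const_mul]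
  refine norm_integral_le_of_norm_le (hF.norm.const_mul C) ?_
  exact ae_restrict_of_forall_mem measurableSet_Iic fun y hy =>
    ContinuousLinearMap.le_of_opNorm_le _ (hA _ (sub_nonneg.2 hy)) _

theorem IsForwardBounded.tendsto_duhamel (hA : IsForwardBounded A C) {F : ℝ → E}
    (hF : ∀ x, IntegrableOn F (Set.Iic x)) :
    Tendsto (duhamel A F) atBot (𝓝 0) := by
  refine squeeze_zero_norm (fun x => hA.norm_duhamel_le (hF x)) ?_
  simpa only [mul_zero, id] using
    (tendsto_integral_Iic_zero (f := fun y => ‖F y‖) tendsto_id).const_mul C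

section WeightedSource

open scoped BoundedContinuousFunction

/-- The weight `e^{2(C+1) ∫_{-∞}^x ‖M‖}`: in the sup norm divided by it, the Volterra operator of
`w' = A w + M w` is a contraction. -/
def volterraWeight (M : ℝ → E →L[ℂ] E) (C x : ℝ) : ℝ :=
  Real.exp (2 * (C + 1) * ∫ y in Set.Iic x, ‖M y‖)

/-- The inhomogeneity `M w` for a function `w` written as a multiple `v` of `volterraWeight`. -/
def weightedSource (M : ℝ → E →L[ℂ] E) (C : ℝ) (v : ℝ →ᵇ E) (y : ℝ) : E :=
  M y (volterraWeight M C y • v y)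

variable {M : ℝ → E →L[ℂ] E}

theorem volterraWeight_pos (M : ℝ → E →L[ℂ] E) (C x : ℝ) : 0 < volterraWeight M C x :=
  Real.exp_pos _

theorem one_le_volterraWeight (M : ℝ → E →L[ℂ] E) (hC : 0 ≤ C) (x : ℝ) :
    1 ≤ volterraWeight M C x :=
  Real.one_le_exp (mul_nonneg (by positivity) (integral_nonneg fun _ => norm_nonneg _))

theorem norm_weightedSource_le (v : ℝ →ᵇ E) (y : ℝ) :
    ‖weightedSource M C v y‖ ≤ ‖v‖ * (‖M y‖ * volterraWeight M C y) := by
  calc ‖weightedSource M C v y‖ ≤ ‖M y‖ * ‖volterraWeight M C y • v y‖ := (M y).le_opNorm _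
    _ = ‖M y‖ * (volterraWeight M C y * ‖v y‖) := by
      rw [norm_smul, Real.norm_of_nonneg (volterraWeight_pos M C y).le]
    _ ≤ ‖M y‖ * (volterraWeight M C y * ‖v‖) := by
      have := (volterraWeight_pos M C y).le
      gcongr
      exact v.norm_coe_le_norm y
    _ = ‖v‖ * (‖M y‖ * volterraWeight M C y) := by ring

theorem weightedSource_sub (v v' : ℝ →ᵇ E) :
    weightedSource M C (v - v') = fun y => weightedSource M C v y - weightedSource M C v' y := by
  funext y
  simp only [weightedSource, BoundedContinuousFunction.sub_apply, smul_sub, map_sub]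

variable (hMc : Continuous M) (hM : ∀ x, IntegrableOn M (Set.Iic x))

include hMc hM

theorem continuous_volterraWeight : Continuous (volterraWeight M C) :=
  ((continuous_setIntegral_Iic hMc.norm fun x => (hM x).norm).const_mul _).rexp

theorem continuous_weightedSource (v : ℝ →ᵇ E) : Continuous (weightedSource M C v) :=
  hMc.clm_apply ((continuous_volterraWeight hMc hM).smul v.continuous)

theorem integrableOn_weightedSource (hC : 0 ≤ C) (v : ℝ →ᵇ E) (x : ℝ) :
    IntegrableOn (weightedSource M C v) (Set.Iic x) :=
  ((integrableOn_Iic_mul_exp_setIntegral hMc.norm (fun _ => norm_nonneg _) (fun x => (hM x).norm)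
    (by positivity) x).const_mul ‖v‖).mono'
      (continuous_weightedSource hMc hM v).aestronglyMeasurable
      (Eventually.of_forall (norm_weightedSource_le v))

theorem IsForwardBounded.norm_inv_volterraWeight_smul_duhamel_le (hA : IsForwardBounded A C)
    (v : ℝ →ᵇ E) (x : ℝ) :
    ‖(volterraWeight M C x)⁻¹ • duhamel A (weightedSource M C v) x‖ ≤ ‖v‖ / 2 := by
  have hC := hA.nonneg
  have hρ := volterraWeight_pos M C x
  have hFi := integrableOn_weightedSource hMc hM hC v x
  have hL : 0 < 2 * (C + 1) := by linarith
  have hint : IntegrableOn (fun y => ‖M y‖ * volterraWeight M C y) (Set.Iic x) :=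
    integrableOn_Iic_mul_exp_setIntegral hMc.norm (fun _ => norm_nonneg _)
      (fun x => (hM x).norm) hL.le x
  have total : ∫ y in Set.Iic x, ‖M y‖ * volterraWeight M C y
      = (volterraWeight M C x - 1) / (2 * (C + 1)) :=
    setIntegral_Iic_mul_exp_setIntegral hMc.norm (fun _ => norm_nonneg _)
      (fun x => (hM x).norm) hL x
  rw [norm_smul, norm_inv, Real.norm_of_nonneg hρ.le, inv_mul_le_iff₀ hρ]
  calc ‖duhamel A (weightedSource M C v) x‖
      ≤ C * ∫ y in Set.Iic x, ‖weightedSource M C v y‖ := hA.norm_duhamel_le hFi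
    _ ≤ C * ∫ y in Set.Iic x, ‖v‖ * (‖M y‖ * volterraWeight M C y) :=
      mul_le_mul_of_nonneg_left
        (integral_mono hFi.norm (hint.const_mul _) (norm_weightedSource_le v)) hC
    _ = C / (C + 1) * (‖v‖ / 2 * (volterraWeight M C x - 1)) := by
      rw [integral_const_mul, total]
      field_simp
    _ ≤ 1 * (‖v‖ / 2 * (volterraWeight M C x - 1)) :=
      mul_le_mul_of_nonneg_right ((div_le_one₀ (by linarith)).2 (by linarith))
        (mul_nonneg (by positivity) (sub_nonneg.2 (one_le_volterraWeight M hC x)))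
    _ ≤ volterraWeight M C x * (‖v‖ / 2) := by nlinarith [norm_nonneg v]

end WeightedSource

variable [CompleteSpace E]

theorem exp_add_smul (A : E →L[ℂ] E) (s t : ℝ) :
    exp ((s + t) • A) = exp (s • A) * exp (t • A) := by
  let _ : NormedAlgebra ℚ (E →L[ℂ] E) := .restrictScalars ℚ ℂ _
  rw [add_smul]
  exact NormedSpace.exp_add_of_commute (((Commute.refl A).smul_left s).smul_right t)

theorem continuous_exp_smul (A : E →L[ℂ] E) : Continuous fun s : ℝ => exp (s • A) :=
  continuous_iff_continuousAt.2 fun s => (hasDerivAt_exp_smul_const (𝕂 := ℝ) A s).continuousAt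

theorem hasDerivAt_exp_smul_apply (A : E →L[ℂ] E) {c : ℝ → ℝ} {v : ℝ → E} {c' : ℝ} {v' : E} {x : ℝ}
    (hc : HasDerivAt c c' x) (hv : HasDerivAt v v' x) :
    HasDerivAt (fun x => exp (c x • A) (v x)) (exp (c x • A) (c' • A (v x) + v')) x := by
  have hexp : HasDerivAt (fun x => exp (c x • A)) (c' • (exp (c x • A) * A)) x :=
    (hasDerivAt_exp_smul_const (𝕂 := ℝ) A (c x)).scomp x hc
  rw [map_add, (exp (c x • A)).map_smul_of_tower]
  exact ((ContinuousLinearMap.restrictScalarsL ℂ E E ℝ ℝ).hasFDerivAt.comp_hasDerivAt x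
    hexp).clm_apply hv

namespace IsForwardBounded

theorem of_isIdempotentElem {R : E →L[ℂ] E} (hR : IsIdempotentElem R) {μ : ℂ} (hμ : μ.re ≤ 0) :
    IsForwardBounded (μ • R) (‖1 - R‖ + ‖R‖) := fun s hs => by
  have contractive : ‖Complex.exp (s * μ)‖ ≤ 1 := by
    rw [Complex.norm_exp, Complex.re_ofReal_mul]
    exact Real.exp_le_one_iff.2 (mul_nonpos_of_nonneg_of_nonpos hs hμ)
  rw [← Complex.coe_smul, smul_smul, exp_smul_of_isIdempotentElem hR]
  refine (norm_add_le _ _).trans (add_le_add_right ?_ _)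
  rw [norm_smul]
  exact mul_le_of_le_one_left (norm_nonneg _) contractive

variable (hA : IsForwardBounded A C)
include hA

variable {F : ℝ → E} {x : ℝ}

theorem integrableOn (hF : IntegrableOn F (Set.Iic x)) :
    IntegrableOn (fun y => exp ((x - y) • A) (F y)) (Set.Iic x) :=
  (ContinuousLinearMap.id ℂ (E →L[ℂ] E)).integrable_of_bilin_of_bdd_left C
    ((continuous_exp_smul A).comp (by fun_prop)).aestronglyMeasurable
    (ae_restrict_of_forall_mem measurableSet_Iic fun y hy => hA _ (sub_nonneg.2 hy)) hF

theorem duhamel_sub {G : ℝ → E} (hF : IntegrableOn F (Set.Iic x))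
    (hG : IntegrableOn G (Set.Iic x)) :
    duhamel A (fun y => F y - G y) x = duhamel A F x - duhamel A G x := by
  simp only [duhamel, map_sub]
  exact integral_sub (hA.integrableOn hF) (hA.integrableOn hG)

theorem hasDerivAt_duhamel (hFc : Continuous F) (hF : ∀ x, IntegrableOn F (Set.Iic x)) (x : ℝ) :
    HasDerivAt (duhamel A F) (A (duhamel A F x) + F x) x := by
  have exp_split : ∀ s t : ℝ, ∀ v, exp ((s - t) • A) v = exp (s • A) (exp ((-t) • A) v) :=
    fun s t v => by rw [sub_eq_add_neg, exp_add_smul]; rfl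
  have exp_split' : ∀ s t : ℝ, ∀ v, exp ((-t) • A) v = exp ((-s) • A) (exp ((s - t) • A) v) :=
    fun s t v => by rw [← neg_add_cancel_left s (-t), exp_add_smul, ← sub_eq_add_neg]; rfl
  have hint : ∀ s, IntegrableOn (fun y => exp ((-y) • A) (F y)) (Set.Iic s) := fun s => by
    rw [funext fun y => exp_split' s y (F y)]
    exact (exp ((-s) • A)).integrable_comp (hA.integrableOn (hF s))
  have factor : duhamel A F = fun s => exp (s • A) (∫ y in Set.Iic s, exp ((-y) • A) (F y)) := by
    funext s
    simp only [duhamel, exp_split s]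
    exact (exp (s • A)).integral_comp_comm (hint s)
  have hcont : Continuous fun y : ℝ => exp ((-y) • A) (F y) :=
    ((continuous_exp_smul A).comp continuous_neg).clm_apply hFc
  have hFx : exp (x • A) (exp ((-x) • A) (F x)) = F x := by
    rw [← exp_split, sub_self, zero_smul, NormedSpace.exp_zero]; rfl
  have hderiv := hasDerivAt_exp_smul_apply A (hasDerivAt_id x)
    (hasDerivAt_setIntegral_Iic hcont hint x)
  simp only [id, one_smul, map_add, hFx, exp_smul_apply_comm] at hderiv
  rwa [factor]

theorem continuous_duhamel (hFc : Continuous F) (hF : ∀ x, IntegrableOn F (Set.Iic x)) :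
    Continuous (duhamel A F) :=
  continuous_iff_continuousAt.2 fun x => (hA.hasDerivAt_duhamel hFc hF x).continuousAt

theorem eq_duhamel {w : ℝ → E} (hF : IntegrableOn F (Set.Iic x))
    (hw : ∀ x, HasDerivAt w (A (w x) + F x) x) (hlim : Tendsto w atBot (𝓝 0)) :
    w x = duhamel A F x := by
  have hderiv : ∀ y, HasDerivAt (fun y => exp ((x - y) • A) (w y)) (exp ((x - y) • A) (F y)) y := by
    intro y
    refine (hasDerivAt_exp_smul_apply A ((hasDerivAt_id y).const_sub x) (hw y)).congr_deriv ?_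
    rw [neg_one_smul, neg_add_cancel_left, id]
  have hvanish : Tendsto (fun y => exp ((x - y) • A) (w y)) atBot (𝓝 0) := by
    refine squeeze_zero_norm' (a := fun y => C * ‖w y‖) ?_ ?_
    · filter_upwards [eventually_le_atBot x] with y hy
      exact ContinuousLinearMap.le_of_opNorm_le _ (hA _ (sub_nonneg.2 hy)) _
    · simpa only [norm_zero, mul_zero] using hlim.norm.const_mul C
  have := integral_Iic_of_hasDerivAt_of_tendsto' (fun y _ => hderiv y) (hA.integrableOn hF)
    hvanish
  rw [duhamel, this, sub_self, zero_smul, NormedSpace.exp_zero, sub_zero]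
  rfl

section Perturbation

variable {M : ℝ → E →L[ℂ] E} (hMc : Continuous M) (hM : ∀ x, IntegrableOn M (Set.Iic x))

include hMc hM

theorem eq_zero_of_hasDerivAt {w : ℝ → E} (hw : ∀ x, HasDerivAt w (A (w x) + M x (w x)) x)
    (hlim : Tendsto w atBot (𝓝 0)) : w = 0 := by
  have hwc : Continuous w := continuous_iff_continuousAt.2 fun x => (hw x).continuousAt
  have bounded : ∀ x, ∃ K, ∀ᵐ y ∂volume.restrict (Set.Iic x), ‖w y‖ ≤ K := fun x =>
    (exists_forall_le_norm_le_of_tendsto_atBot hwc hlim x).imp fun _ hK =>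
      ae_restrict_of_forall_mem measurableSet_Iic hK
  have hMw : ∀ x, IntegrableOn (fun y => M y (w y)) (Set.Iic x) := fun x =>
    let ⟨K, hK⟩ := bounded x
    (ContinuousLinearMap.id ℂ (E →L[ℂ] E)).integrable_of_bilin_of_bdd_right K (hM x)
      hwc.aestronglyMeasurable hK
  have hnorm : ∀ x, IntegrableOn (fun y => C * ‖M y‖ * ‖w y‖) (Set.Iic x) := fun x =>
    let ⟨K, hK⟩ := bounded x
    ((hM x).norm.const_mul C).mul_bdd hwc.norm.aestronglyMeasurable
      (hK.mono fun _ h => (norm_norm _).trans_le h)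
  have volterra : ∀ x, ‖w x‖ ≤ 0 + ∫ y in Set.Iic x, C * ‖M y‖ * ‖w y‖ := fun x => by
    rw [hA.eq_duhamel (hMw x) hw hlim]
    refine (hA.norm_duhamel_le (hMw x)).trans ?_
    rw [zero_add, ← integral_const_mul]
    refine setIntegral_mono_on ((hMw x).norm.const_mul C) (hnorm x) measurableSet_Iic fun y _ => ?_
    rw [mul_assoc]
    exact mul_le_mul_of_nonneg_left ((M y).le_opNorm _) hA.nonneg
  funext x
  have := le_mul_exp_of_le_add_setIntegral_Iic (m := fun y => C * ‖M y‖) (by fun_prop)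
    (fun _ => mul_nonneg hA.nonneg (norm_nonneg _)) (fun y => (hM y).norm.const_mul C)
    hwc.norm hnorm volterra x
  rwa [zero_mul, norm_le_zero_iff] at this

open scoped BoundedContinuousFunction in
theorem exists_contractingWith (w₀ : E) :
    ∃ T : (ℝ →ᵇ E) → ℝ →ᵇ E, ContractingWith (1 / 2) T ∧ ∀ v x,
      T v x = (volterraWeight M C x)⁻¹ • (w₀ + duhamel A (weightedSource M C v) x) := by
  have hρ : ∀ x, ‖(volterraWeight M C x)⁻¹‖ ≤ 1 := fun x => by
    rw [norm_inv, Real.norm_of_nonneg (volterraWeight_pos M C x).le]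
    exact inv_le_one_of_one_le₀ (one_le_volterraWeight M hA.nonneg x)
  have half := hA.norm_inv_volterraWeight_smul_duhamel_le hMc hM
  let T : (ℝ →ᵇ E) → ℝ →ᵇ E := fun v => .ofNormedAddCommGroup
    (fun x => (volterraWeight M C x)⁻¹ • (w₀ + duhamel A (weightedSource M C v) x))
    (((continuous_volterraWeight hMc hM).inv₀ fun x => (volterraWeight_pos M C x).ne').smul
      (continuous_const.add (hA.continuous_duhamel (continuous_weightedSource hMc hM v)
        (integrableOn_weightedSource hMc hM hA.nonneg v))))
    (‖w₀‖ + ‖v‖ / 2) fun x => by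
      rw [smul_add]
      refine (norm_add_le _ _).trans (add_le_add ?_ (half v x))
      exact (norm_smul_le _ _).trans (mul_le_of_le_one_left (norm_nonneg _) (hρ x))
  refine ⟨T, ⟨one_half_lt_one, LipschitzWith.of_dist_le_mul fun v v' => ?_⟩, fun v x => rfl⟩
  refine (BoundedContinuousFunction.dist_le (by positivity)).2 fun x => ?_
  have difference : T v x - T v' x
      = (volterraWeight M C x)⁻¹ • duhamel A (weightedSource M C (v - v')) x := by
    rw [weightedSource_sub, hA.duhamel_sub (integrableOn_weightedSource hMc hM hA.nonneg v x)
      (integrableOn_weightedSource hMc hM hA.nonneg v' x)]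
    rw [← add_sub_add_left_eq_sub (duhamel _ _ x) _ w₀, smul_sub]
    rfl
  rw [dist_eq_norm, difference, dist_eq_norm]
  exact (half _ x).trans_eq (by push_cast; ring)

theorem exists_hasDerivAt {w₀ : E} (hw₀ : A w₀ = 0) :
    ∃ w : ℝ → E, (∀ x, HasDerivAt w (A (w x) + M x (w x)) x) ∧ Tendsto w atBot (𝓝 w₀) := by
  obtain ⟨T, hT, T_apply⟩ := hA.exists_contractingWith hMc hM w₀
  obtain ⟨v, hv⟩ : ∃ v, T v = v := ⟨_, hT.fixedPoint_isFixedPt⟩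
  have weighted : ∀ x, volterraWeight M C x • v x = w₀ + duhamel A (weightedSource M C v) x :=
    fun x => by
      conv_lhs => rw [← hv, T_apply, smul_inv_smul₀ (volterraWeight_pos M C x).ne']
  have hF := continuous_weightedSource (C := C) hMc hM v
  have hFi := integrableOn_weightedSource hMc hM hA.nonneg v
  refine ⟨fun x => w₀ + duhamel A (weightedSource M C v) x, fun x => ?_, ?_⟩
  · refine ((hA.hasDerivAt_duhamel hF hFi x).const_add w₀).congr_deriv ?_
    rw [map_add A, hw₀, zero_add, weightedSource, weighted]
  · simpa only [add_zero] using (hA.tendsto_duhamel hFi).const_add w₀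

theorem existsUnique_hasDerivAt {w₀ : E} (hw₀ : A w₀ = 0) :
    ∃! w : ℝ → E, (∀ x, HasDerivAt w (A (w x) + M x (w x)) x) ∧ Tendsto w atBot (𝓝 w₀) := by
  obtain ⟨w, hw, hlim⟩ := hA.exists_hasDerivAt hMc hM hw₀
  refine ⟨w, ⟨hw, hlim⟩, fun w' ⟨hw', hlim'⟩ => sub_eq_zero.1 ?_⟩
  refine hA.eq_zero_of_hasDerivAt hMc hM (fun x => ?_) (sub_self w₀ ▸ hlim'.sub hlim)
  refine ((hw' x).sub (hw x)).congr_deriv ?_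
  simp only [Pi.sub_apply, map_sub]
  abel

end Perturbation

end IsForwardBounded

end Volterra

section Decay

variable {E : Type*} [NormedAddCommGroup E] [NormedSpace ℂ E]

theorem exists_contDiff_hasCompactSupport_setIntegral_norm_sub_le {F : ℝ → E} {x : ℝ}
    (hF : IntegrableOn F (Set.Iic x)) {ε : ℝ} (hε : 0 < ε) :
    ∃ g : ℝ → E, ContDiff ℝ 1 g ∧ HasCompactSupport g ∧ IntegrableOn g (Set.Iic x) ∧
      ∫ y in Set.Iic x, ‖F y - g y‖ ≤ ε := by
  obtain ⟨g, hgc, hg, hFg⟩ := MemLp.exist_eLpNorm_sub_le ENNReal.one_ne_top le_rfl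
    (memLp_one_iff_integrable.2 hF) hε
  have hgi : IntegrableOn g (Set.Iic x) :=
    (hg.continuous.integrable_of_hasCompactSupport hgc).integrableOn
  refine ⟨g, hg.of_le (mod_cast le_top), hgc, hgi, ?_⟩
  rw [eLpNorm_one_eq_lintegral_enorm,
    ← ofReal_integral_norm_eq_lintegral_enorm (hF.sub hgi)] at hFg
  exact (ENNReal.ofReal_le_ofReal_iff hε.le).1 hFg

variable [CompleteSpace E]

theorem norm_le_setIntegral_norm_of_hasDerivAt {μ : ℂ} (hμ : μ.re ≤ 0) {b F : ℝ → E}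
    (hb : ∀ x, HasDerivAt b (μ • b x + F x) x) (hlim : Tendsto b atBot (𝓝 0)) {x : ℝ}
    (hF : IntegrableOn F (Set.Iic x)) : ‖b x‖ ≤ ∫ y in Set.Iic x, ‖F y‖ := by
  have hA := IsForwardBounded.of_isIdempotentElem (R := (1 : E →L[ℂ] E)) .one hμ
  have constant_le : ‖1 - (1 : E →L[ℂ] E)‖ + ‖(1 : E →L[ℂ] E)‖ ≤ 1 := by
    rw [sub_self, norm_zero, zero_add]
    exact ContinuousLinearMap.norm_id_le
  rw [hA.eq_duhamel hF hb hlim]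
  exact (hA.norm_duhamel_le hF).trans
    (mul_le_of_le_one_left (integral_nonneg fun _ => norm_nonneg _) constant_le)

-- `b + μ⁻¹ g` solves the equation with the inhomogeneity `F - g + μ⁻¹ g'`.
theorem norm_le_div_norm_add_setIntegral_norm_sub {μ : ℂ} (hμ : μ.re ≤ 0) (hμ₀ : μ ≠ 0)
    {b F : ℝ → E} (hb : ∀ x, HasDerivAt b (μ • b x + F x) x) (hlim : Tendsto b atBot (𝓝 0))
    {x : ℝ} (hF : IntegrableOn F (Set.Iic x)) {g : ℝ → E} (hg : ContDiff ℝ 1 g)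
    (hgc : HasCompactSupport g) :
    ‖b x‖ ≤ (‖g x‖ + ∫ y in Set.Iic x, ‖deriv g y‖) / ‖μ‖ + ∫ y in Set.Iic x, ‖F y - g y‖ := by
  have hgi : IntegrableOn g (Set.Iic x) :=
    (hg.continuous.integrable_of_hasCompactSupport hgc).integrableOn
  have hg'i : IntegrableOn (deriv g) (Set.Iic x) :=
    (hg.continuous_deriv_one.integrable_of_hasCompactSupport hgc.deriv).integrableOn
  have hg0 : Tendsto g atBot (𝓝 0) :=
    (hgc.is_zero_at_infty.mono_left atBot_le_cocompact)
  have corrected : ∀ y, HasDerivAt (fun y => b y + μ⁻¹ • g y)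
      (μ • (b y + μ⁻¹ • g y) + (F y - g y + μ⁻¹ • deriv g y)) y := fun y => by
    refine ((hb y).fun_add
      ((hg.differentiable one_ne_zero y).hasDerivAt.const_smul μ⁻¹)).congr_deriv ?_
    rw [smul_add, smul_inv_smul₀ hμ₀]
    abel
  have hlim' : Tendsto (fun y => b y + μ⁻¹ • g y) atBot (𝓝 0) := by
    simpa only [smul_zero, add_zero] using hlim.add (hg0.const_smul μ⁻¹)
  have hFg : IntegrableOn (fun y => ‖F y - g y‖) (Set.Iic x) := (hF.sub hgi).norm
  have hg' : IntegrableOn (fun y => ‖μ‖⁻¹ * ‖deriv g y‖) (Set.Iic x) := hg'i.norm.const_mul _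
  have hsource : IntegrableOn (fun y => F y - g y + μ⁻¹ • deriv g y) (Set.Iic x) :=
    (hF.sub hgi).add (hg'i.smul μ⁻¹)
  calc ‖b x‖ ≤ ‖b x + μ⁻¹ • g x‖ + ‖μ⁻¹ • g x‖ := norm_le_add_norm_add _ _
    _ ≤ (∫ y in Set.Iic x, (‖F y - g y‖ + ‖μ‖⁻¹ * ‖deriv g y‖)) + ‖μ‖⁻¹ * ‖g x‖ := by
      refine add_le_add ?_ (by rw [norm_smul, norm_inv])
      refine (norm_le_setIntegral_norm_of_hasDerivAt hμ corrected hlim' hsource).trans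
        (integral_mono hsource.norm (hFg.add hg') fun y => ?_)
      exact (norm_add_le _ _).trans_eq (by rw [norm_smul, norm_inv])
    _ = _ := by
      rw [integral_add hFg hg', integral_const_mul]
      ring

theorem tendsto_zero_of_hasDerivAt {ι : Type*} {l : Filter ι} {μ : ι → ℂ} {b F : ι → ℝ → E}
    {F₀ : ℝ → E} {x : ℝ} (hμ : ∀ᶠ i in l, (μ i).re ≤ 0)
    (hinf : Tendsto (fun i => ‖μ i‖) l atTop)
    (hb : ∀ᶠ i in l, ∀ y, HasDerivAt (b i) (μ i • b i y + F i y) y)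
    (hlim : ∀ᶠ i in l, Tendsto (b i) atBot (𝓝 0))
    (hF : ∀ᶠ i in l, IntegrableOn (F i) (Set.Iic x)) (hF₀ : IntegrableOn F₀ (Set.Iic x))
    (hFF₀ : Tendsto (fun i => ∫ y in Set.Iic x, ‖F i y - F₀ y‖) l (𝓝 0)) :
    Tendsto (fun i => b i x) l (𝓝 0) := by
  refine Metric.tendsto_nhds.2 fun ε hε => ?_
  obtain ⟨g, hg, hgc, hgi, hgF⟩ :=
    exists_contDiff_hasCompactSupport_setIntegral_norm_sub_le hF₀ (by positivity : 0 < ε / 3)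
  have boundary : Tendsto (fun i => (‖g x‖ + ∫ y in Set.Iic x, ‖deriv g y‖) / ‖μ i‖) l (𝓝 0) :=
    hinf.const_div_atTop _
  filter_upwards [hμ, hb, hlim, hF, hinf.eventually_gt_atTop 0,
    boundary.eventually_lt_const (by positivity : 0 < ε / 3),
    hFF₀.eventually_lt_const (by positivity : 0 < ε / 3)]
    with i hμi hbi hlimi hFi hμ_pos hboundary hdist
  have hbx := norm_le_div_norm_add_setIntegral_norm_sub hμi (norm_pos_iff.1 hμ_pos) hbi hlimi hFi
    hg hgc
  have hFiF₀ : IntegrableOn (fun y => ‖F i y - F₀ y‖) (Set.Iic x) := (hFi.sub hF₀).norm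
  have hF₀g : IntegrableOn (fun y => ‖F₀ y - g y‖) (Set.Iic x) := (hF₀.sub hgi).norm
  have triangle : ∫ y in Set.Iic x, ‖F i y - g y‖
      ≤ (∫ y in Set.Iic x, ‖F i y - F₀ y‖) + ∫ y in Set.Iic x, ‖F₀ y - g y‖ := by
    rw [← integral_add hFiF₀ hF₀g]
    exact integral_mono (hFi.sub hgi).norm (hFiF₀.add hF₀g) fun y =>
      norm_sub_le_norm_sub_add_norm_sub _ _ _
  rw [dist_zero_right]
  linarith

end Decay

section OffDiagonal

/-- The system `a' = α b`, `b' = μ b + β a` with data `(1, 0)` at `-∞`, the form in which the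
spatial equation is studied for large `μ`. -/
structure IsOffDiagonal (μ : ℂ) (α β a b : ℝ → ℂ) : Prop where
  hasDerivAt_fst : ∀ x, HasDerivAt a (α x * b x) x
  hasDerivAt_snd : ∀ x, HasDerivAt b (μ * b x + β x * a x) x
  tendsto_fst : Tendsto a atBot (𝓝 1)
  tendsto_snd : Tendsto b atBot (𝓝 0)

/-- Bounds on `(-∞, X]` for the coefficients of an off-diagonal system: `α` is only bounded, but
`α'` and `β` are dominated by an integrable function `m`. -/
structure IsDominated (α β : ℝ → ℂ) (X C : ℝ) (m : ℝ → ℝ) : Prop where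
  differentiable : Differentiable ℝ α
  aestronglyMeasurable : AEStronglyMeasurable β (volume.restrict (Set.Iic X))
  norm_fst_le : ∀ x ≤ X, ‖α x‖ ≤ C
  norm_deriv_le : ∀ x ≤ X, ‖deriv α x‖ ≤ m x
  norm_snd_le : ∀ x ≤ X, ‖β x‖ ≤ m x
  integrableOn_bound : IntegrableOn m (Set.Iic X)

namespace IsDominated

variable {α β a b : ℝ → ℂ} {X C A : ℝ} {m : ℝ → ℝ} (h : IsDominated α β X C m)

include h

theorem bound_nonneg {x : ℝ} (hx : x ≤ X) : 0 ≤ m x :=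
  (norm_nonneg _).trans (h.norm_snd_le x hx)

theorem const_nonneg : 0 ≤ C := (norm_nonneg _).trans (h.norm_fst_le X le_rfl)

theorem setIntegral_bound_nonneg : 0 ≤ ∫ y in Set.Iic X, m y :=
  setIntegral_nonneg measurableSet_Iic fun _ hx => h.bound_nonneg hx

theorem setIntegral_bound_mono {x : ℝ} (hx : x ≤ X) :
    ∫ y in Set.Iic x, m y ≤ ∫ y in Set.Iic X, m y :=
  setIntegral_mono_set h.integrableOn_bound
    (ae_restrict_of_forall_mem measurableSet_Iic fun _ hy => h.bound_nonneg hy)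
    (Set.Iic_subset_Iic.2 hx).eventuallyLE

theorem setIntegral_norm_le {f : ℝ → ℂ} {K x : ℝ} (hK : 0 ≤ K) (hf : ∀ y ≤ X, ‖f y‖ ≤ m y * K)
    (hx : x ≤ X) : ∫ y in Set.Iic x, ‖f y‖ ≤ (∫ y in Set.Iic X, m y) * K := by
  have hmK : IntegrableOn (fun y => m y * K) (Set.Iic x) :=
    (h.integrableOn_bound.mono_set (Set.Iic_subset_Iic.2 hx)).mul_const K
  calc ∫ y in Set.Iic x, ‖f y‖ ≤ ∫ y in Set.Iic x, m y * K :=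
      integral_mono_of_nonneg (Eventually.of_forall fun _ => norm_nonneg _) hmK
        (ae_restrict_of_forall_mem measurableSet_Iic fun y hy => hf y (hy.trans hx))
    _ = (∫ y in Set.Iic x, m y) * K := integral_mul_const K _
    _ ≤ _ := mul_le_mul_of_nonneg_right (h.setIntegral_bound_mono hx) hK

theorem norm_snd_mul_le (ha : ∀ x ≤ X, ‖a x‖ ≤ A) {x : ℝ} (hx : x ≤ X) :
    ‖β x * a x‖ ≤ m x * A :=
  norm_mul_le_of_le (h.norm_snd_le x hx) (ha x hx)

theorem integrableOn_snd_mul (hac : Continuous a) (ha : ∀ x ≤ X, ‖a x‖ ≤ A) :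
    IntegrableOn (fun y => β y * a y) (Set.Iic X) :=
  (h.integrableOn_bound.mul_const A).mono' (h.aestronglyMeasurable.mul hac.aestronglyMeasurable)
    (ae_restrict_of_forall_mem measurableSet_Iic fun _ hy => h.norm_snd_mul_le ha hy)

end IsDominated

namespace IsOffDiagonal

variable {μ : ℂ} {α β a b : ℝ → ℂ} {X C A : ℝ} {m : ℝ → ℝ}

theorem continuous_fst (h : IsOffDiagonal μ α β a b) : Continuous a :=
  continuous_iff_continuousAt.2 fun x => (h.hasDerivAt_fst x).continuousAt

variable (h : IsOffDiagonal μ α β a b) (hd : IsDominated α β X C m) (hμ : μ.re ≤ 0)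

include h hd hμ

theorem norm_snd_le (ha : ∀ x ≤ X, ‖a x‖ ≤ A) {x : ℝ} (hx : x ≤ X) :
    ‖b x‖ ≤ (∫ y in Set.Iic X, m y) * A :=
  (norm_le_setIntegral_norm_of_hasDerivAt hμ h.hasDerivAt_snd h.tendsto_snd
    ((hd.integrableOn_snd_mul h.continuous_fst ha).mono_set (Set.Iic_subset_Iic.2 hx))).trans
    (hd.setIntegral_norm_le ((norm_nonneg _).trans (ha X le_rfl))
      (fun _ hy => hd.norm_snd_mul_le ha hy) hx)

-- The combination `α b - μ a` has the derivative `α' b + α β a`, which is free of the large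
-- parameter and integrable although `α` itself is not.
theorem norm_mul_norm_fst_sub_one_le (ha : ∀ x ≤ X, ‖a x‖ ≤ A) {x : ℝ} (hx : x ≤ X) :
    ‖μ‖ * ‖a x - 1‖ ≤ (2 * C * (∫ y in Set.Iic X, m y) + (∫ y in Set.Iic X, m y) ^ 2) * A := by
  set J := ∫ y in Set.Iic X, m y
  have hA : 0 ≤ A := (norm_nonneg _).trans (ha X le_rfl)
  have hb := fun y (hy : y ≤ X) => h.norm_snd_le hd hμ ha hy
  have hC := hd.const_nonneg
  have hJ : 0 ≤ J := hd.setIntegral_bound_nonneg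
  set f : ℝ → ℂ := fun y => deriv α y * b y + α y * (β y * a y)
  have hf : ∀ y ≤ X, ‖f y‖ ≤ m y * (J * A + C * A) := fun y hy => by
    refine (norm_add_le_of_le (norm_mul_le_of_le (hd.norm_deriv_le y hy) (hb y hy))
      (norm_mul_le_of_le (hd.norm_fst_le y hy) (hd.norm_snd_mul_le ha hy))).trans_eq (by ring)
  have hbc : Continuous b :=
    continuous_iff_continuousAt.2 fun y => (h.hasDerivAt_snd y).continuousAt
  have hfi : IntegrableOn f (Set.Iic x) := by
    refine Integrable.mono' ((hd.integrableOn_bound.mono_set (Set.Iic_subset_Iic.2 hx)).mul_const _)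
      ?_ (ae_restrict_of_forall_mem measurableSet_Iic fun y hy => hf y (hy.trans hx))
    exact ((measurable_deriv α).aestronglyMeasurable.mul hbc.aestronglyMeasurable).add
      (hd.differentiable.continuous.aestronglyMeasurable.mul
        ((hd.aestronglyMeasurable.mono_set (Set.Iic_subset_Iic.2 hx)).mul
          h.continuous_fst.aestronglyMeasurable))
  have hderiv : ∀ y, HasDerivAt (fun y => α y * b y - μ * a y) (f y) y := fun y => by
    refine (((hd.differentiable y).hasDerivAt.fun_mul (h.hasDerivAt_snd y)).fun_sub
      ((h.hasDerivAt_fst y).const_mul μ)).congr_deriv ?_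
    ring
  have αb_vanishes : Tendsto (fun y => α y * b y) atBot (𝓝 0) :=
    isBoundedUnder_le_mul_tendsto_zero
      (isBoundedUnder_of_eventually_le ((eventually_le_atBot X).mono hd.norm_fst_le)) h.tendsto_snd
  have hint := integral_Iic_of_hasDerivAt_of_tendsto' (fun y _ => hderiv y) hfi
    (αb_vanishes.sub (h.tendsto_fst.const_mul μ))
  calc ‖μ‖ * ‖a x - 1‖ = ‖α x * b x - ∫ y in Set.Iic x, f y‖ := by
        rw [← norm_mul, hint]
        ring_nf
    _ ≤ C * (J * A) + J * (J * A + C * A) :=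
      norm_sub_le_of_le (norm_mul_le_of_le (hd.norm_fst_le x hx) (hb x hx))
        ((norm_integral_le_integral_norm _).trans (hd.setIntegral_norm_le (by positivity) hf hx))
    _ = _ := by ring

theorem norm_fst_le_two (hμ₀ : μ ≠ 0)
    (hlarge : 2 * (2 * C * (∫ y in Set.Iic X, m y) + (∫ y in Set.Iic X, m y) ^ 2) ≤ ‖μ‖) :
    ∀ x ≤ X, ‖a x‖ ≤ 2 := by
  obtain ⟨A₀, hA₀⟩ :=
    exists_forall_le_norm_le_of_tendsto_atBot h.continuous_fst h.tendsto_fst X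
  have hbdd : BddAbove (Set.range fun y : Set.Iic X => ‖a y‖) :=
    ⟨A₀, Set.forall_mem_range.2 fun y => hA₀ y y.2⟩
  have le_sup : ∀ y ≤ X, ‖a y‖ ≤ ⨆ y : Set.Iic X, ‖a y‖ := fun y hy => le_ciSup hbdd ⟨y, hy⟩
  have : Nonempty (Set.Iic X) := ⟨⟨X, Set.self_mem_Iic⟩⟩
  have sup_le : ⨆ y : Set.Iic X, ‖a y‖ ≤ 1 + (⨆ y : Set.Iic X, ‖a y‖) / 2 := by
    refine ciSup_le fun y => ?_
    have near_one := h.norm_mul_norm_fst_sub_one_le hd hμ le_sup y.2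
    have : ‖a y - 1‖ ≤ (⨆ y : Set.Iic X, ‖a y‖) / 2 := by
      refine le_of_mul_le_mul_left (near_one.trans ?_) (norm_pos_iff.2 hμ₀)
      have := (norm_nonneg _).trans (le_sup X le_rfl)
      nlinarith
    linarith [norm_le_norm_sub_add (a y) 1, norm_one (α := ℂ)]
  exact fun x hx => (le_sup x hx).trans (by linarith)

end IsOffDiagonal

section Asymptotics

variable {ι : Type*} {l : Filter ι} {μ : ι → ℂ} {α β a b : ι → ℝ → ℂ} {X C : ℝ} {m : ℝ → ℝ}
  (h : ∀ᶠ i in l, IsOffDiagonal (μ i) (α i) (β i) (a i) (b i))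
  (hd : ∀ᶠ i in l, IsDominated (α i) (β i) X C m) (hμ : ∀ᶠ i in l, (μ i).re ≤ 0)
  (hinf : Tendsto (fun i => ‖μ i‖) l atTop)

include h hd hμ hinf

theorem IsOffDiagonal.eventually_norm_fst_le_two : ∀ᶠ i in l, ∀ x ≤ X, ‖a i x‖ ≤ 2 := by
  filter_upwards [h, hd, hμ, hinf.eventually_gt_atTop 0, hinf.eventually_ge_atTop _]
    with i h hd hμ hμ_pos hlarge
  exact h.norm_fst_le_two hd hμ (norm_pos_iff.1 hμ_pos) hlarge

theorem IsOffDiagonal.isBigO_fst_sub_one {x : ℝ} (hx : x ≤ X) :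
    (fun i => a i x - 1) =O[l] fun i => (μ i)⁻¹ := by
  refine IsBigO.of_bound ((2 * C * (∫ y in Set.Iic X, m y) + (∫ y in Set.Iic X, m y) ^ 2) * 2) ?_
  filter_upwards [h, hd, hμ, eventually_norm_fst_le_two h hd hμ hinf, hinf.eventually_gt_atTop 0]
    with i h hd hμ ha hμ_pos
  rw [norm_inv, ← div_eq_mul_inv, le_div_iff₀' hμ_pos]
  exact h.norm_mul_norm_fst_sub_one_le hd hμ ha hx

theorem IsOffDiagonal.tendsto_snd_zero [l.IsCountablyGenerated] {β₀ : ℝ → ℂ}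
    (hβ₀ : IntegrableOn β₀ (Set.Iic X))
    (hβ : ∀ x ≤ X, Tendsto (fun i => β i x) l (𝓝 (β₀ x))) :
    Tendsto (fun i => b i X) l (𝓝 0) := by
  rcases l.eq_or_neBot with rfl | _
  · exact tendsto_bot
  have ha := eventually_norm_fst_le_two h hd hμ hinf
  have fst_lim : ∀ x ≤ X, Tendsto (fun i => a i x) l (𝓝 1) := fun x hx =>
    tendsto_sub_nhds_zero_iff.1 ((isBigO_fst_sub_one h hd hμ hinf hx).trans_tendsto
      (tendsto_inv₀_cobounded.comp (tendsto_norm_atTop_iff_cobounded.1 hinf)))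
  have hβa : ∀ᶠ i in l, IntegrableOn (fun y => β i y * a i y) (Set.Iic X) := by
    filter_upwards [h, hd, ha] with i h hd ha using hd.integrableOn_snd_mul h.continuous_fst ha
  refine tendsto_zero_of_hasDerivAt hμ hinf (h.mono fun i h => h.hasDerivAt_snd)
    (h.mono fun i h => h.tendsto_snd) hβa hβ₀ ?_
  rw [← integral_zero ℝ ℝ (μ := volume.restrict (Set.Iic X))]
  refine tendsto_integral_filter_of_dominated_convergence (fun y => m y * 2 + ‖β₀ y‖)
    (hβa.mono fun i h => (h.sub hβ₀).norm.aestronglyMeasurable) ?_ ?_ ?_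
  · filter_upwards [hd, ha] with i hd ha
    refine ae_restrict_of_forall_mem measurableSet_Iic fun y hy => ?_
    rw [norm_norm]
    exact norm_sub_le_of_le (hd.norm_snd_mul_le ha hy) le_rfl
  · obtain ⟨i, hd⟩ := hd.exists
    exact (hd.integrableOn_bound.mul_const 2).add hβ₀.norm
  · refine ae_restrict_of_forall_mem measurableSet_Iic fun y hy => ?_
    simpa only [mul_one, sub_self, norm_zero] using
      (((hβ y hy).mul (fst_lim y hy)).sub_const (β₀ y)).norm

end Asymptotics

end OffDiagonal

section MatrixSystem

theorem isIdempotentElem_inv_trace_smul {K : Type*} [Field K] {A : Matrix (Fin 2) (Fin 2) K}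
    (hdet : A.det = 0) (htr : A.trace ≠ 0) : IsIdempotentElem (A.trace⁻¹ • A) := by
  have cayley_hamilton : A * A = A.trace • A := by
    have := A.aeval_self_charpoly
    rw [A.charpoly_fin_two, hdet] at this
    simpa [sq, sub_eq_zero, ← Algebra.smul_def] using this
  rw [IsIdempotentElem, smul_mul_smul_comm, cayley_hamilton, smul_smul, mul_assoc,
    inv_mul_cancel₀ htr, mul_one]

/-- A complex matrix as a bounded operator on `ℂⁿ`. -/
def mulVecCLM {n : Type*} [Fintype n] [DecidableEq n] :
    Matrix n n ℂ ≃ₐ[ℂ] ((n → ℂ) →L[ℂ] (n → ℂ)) :=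
  Matrix.toLinAlgEquiv'.trans (Module.End.toContinuousLinearMap (𝕜 := ℂ) (n → ℂ))

theorem mulVecCLM_apply {n : Type*} [Fintype n] [DecidableEq n] (A : Matrix n n ℂ) (v : n → ℂ) :
    mulVecCLM A v = A *ᵥ v := rfl

theorem integrableOn_mulVecCLM {n : Type*} [Fintype n] [DecidableEq n] {P : ℝ → Matrix n n ℂ}
    {s : Set ℝ} (hP : ∀ i j, IntegrableOn (fun x => P x i j) s) :
    IntegrableOn (fun x => mulVecCLM (P x)) s := by
  have entries : IntegrableOn (ε := n → n → ℂ) P s :=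
    Integrable.of_eval fun i => Integrable.of_eval fun j => hP i j
  let L : (n → n → ℂ) →ₗ[ℂ] ((n → ℂ) →L[ℂ] (n → ℂ)) := (mulVecCLM (n := n)).toLinearMap
  exact L.toContinuousLinearMap.integrable_comp entries

theorem existsUnique_hasDerivAt_mulVec {P : ℝ → Matrix (Fin 2) (Fin 2) ℂ}
    {A : Matrix (Fin 2) (Fin 2) ℂ} {κ : ℂ} {w₀ : Fin 2 → ℂ} (hPc : Continuous P)
    (hP : ∀ i j x, IntegrableOn (fun y => (P y - A) i j) (Set.Iic x)) (hdet : A.det = 0)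
    (htr : A.trace ≠ 0) (hre : (κ * A.trace).re ≤ 0) (hw₀ : A *ᵥ w₀ = 0) :
    ∃! w : ℝ → Fin 2 → ℂ,
      (∀ x, HasDerivAt w (κ • (P x *ᵥ w x)) x) ∧ Tendsto w atBot (𝓝 w₀) := by
  have hR : IsIdempotentElem (mulVecCLM (A.trace⁻¹ • A)) :=
    (isIdempotentElem_inv_trace_smul hdet htr).map mulVecCLM
  have principal : (κ * A.trace) • mulVecCLM (A.trace⁻¹ • A) = κ • mulVecCLM A := by
    rw [map_smul, smul_smul, mul_assoc, mul_inv_cancel₀ htr, mul_one]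
  have split : ∀ x w, (κ • mulVecCLM A) w + (κ • mulVecCLM (P x - A)) w = κ • (P x *ᵥ w) :=
    fun x w => by
      simp only [_root_.smul_apply, mulVecCLM_apply, Matrix.sub_mulVec, smul_sub, add_sub_cancel]
  have hMc : Continuous fun x => κ • mulVecCLM (P x - A) :=
    (((mulVecCLM (n := Fin 2)).toLinearMap.continuous_of_finiteDimensional).comp
      (hPc.sub continuous_const)).const_smul κ
  have unique := (IsForwardBounded.of_isIdempotentElem hR hre).existsUnique_hasDerivAt hMc
    (fun x => (integrableOn_mulVecCLM fun i j => hP i j x).smul κ) (w₀ := w₀)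
    (by rw [principal, _root_.smul_apply, mulVecCLM_apply, hw₀, smul_zero])
  simpa only [principal, split] using unique

end MatrixSystem

section Reduced

/-- A differentiable function with integrable derivative that approaches the limit `f₀` at `-∞`,
also in `L¹`. -/
structure IsProfile (f : ℝ → ℂ) (f₀ : ℂ) : Prop where
  differentiable : Differentiable ℝ f
  integrable_deriv : Integrable (deriv f)
  tendsto : Tendsto f atBot (𝓝 f₀)
  integrableOn_sub : ∀ x, IntegrableOn (fun y => f y - f₀) (Set.Iic x)

/-- The two potentials `U`, `V` of the reduced system, whose limits at `-∞` have product `c`. -/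
structure IsPotential (c : ℂ) (U V : ℝ → ℂ) (U₀ V₀ : ℂ) : Prop where
  fst : IsProfile U U₀
  snd : IsProfile V V₀
  mul_eq : U₀ * V₀ = c

/-- The common form to which the spatial equations for the four Jost columns are brought by a
reflection of the line, a permutation of the components and a scalar phase. -/
structure IsReduced (c κ₀ : ℂ) (U V : ℝ → ℂ) (V₀ z : ℂ) (w : ℝ → Fin 2 → ℂ) : Prop where
  hasDerivAt : ∀ x, HasDerivAt w ((κ₀ * (z - c / z)) • (!![c / z, U x; V x, z] *ᵥ w x)) x
  tendsto : Tendsto w atBot (𝓝 ![1, -V₀ / z])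

variable {c κ₀ : ℂ} {U V : ℝ → ℂ} {U₀ V₀ z : ℂ} {w : ℝ → Fin 2 → ℂ}

theorem IsProfile.exists_norm_le {f : ℝ → ℂ} {f₀ : ℂ} (hf : IsProfile f f₀) (X : ℝ) :
    ∃ C, ∀ x ≤ X, ‖f x‖ ≤ C :=
  exists_forall_le_norm_le_of_tendsto_atBot hf.differentiable.continuous hf.tendsto X

theorem IsPotential.continuous_defect (h : IsPotential c U V U₀ V₀) :
    Continuous fun x => c - U x * V x :=
  continuous_const.sub (h.fst.differentiable.continuous.mul h.snd.differentiable.continuous)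

theorem IsPotential.integrableOn_defect (h : IsPotential c U V U₀ V₀) (x : ℝ) :
    IntegrableOn (fun y => c - U y * V y) (Set.Iic x) := by
  obtain ⟨C, hC⟩ := h.fst.exists_norm_le x
  have bounded_part : IntegrableOn (fun y => U y * (V y - V₀)) (Set.Iic x) :=
    Integrable.bdd_mul (h.snd.integrableOn_sub x)
      h.fst.differentiable.continuous.aestronglyMeasurable
      (ae_restrict_of_forall_mem measurableSet_Iic hC)
  convert (bounded_part.add ((h.fst.integrableOn_sub x).mul_const V₀)).neg using 2 with y
  simp only [← h.mul_eq, Pi.neg_apply, Pi.add_apply]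
  ring

theorem existsUnique_isReduced (h : IsPotential c U V U₀ V₀) (hz : z ≠ 0) (hzc : z ^ 2 ≠ -c)
    (hre : (κ₀ * (z - c / z) * (z + c / z)).re ≤ 0) :
    ∃! w, IsReduced c κ₀ U V V₀ z w := by
  have hPc : Continuous fun x => !![c / z, U x; V x, z] := by
    have := h.fst.differentiable.continuous
    have := h.snd.differentiable.continuous
    fun_prop
  have hP : ∀ i j x,
      IntegrableOn (fun y => (!![c / z, U y; V y, z] - !![c / z, U₀; V₀, z]) i j) (Set.Iic x) := by
    intro i j x
    fin_cases i <;> fin_cases j <;>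
      simp [h.fst.integrableOn_sub x, h.snd.integrableOn_sub x]
  have hdet : !![c / z, U₀; V₀, z].det = 0 := by
    rw [Matrix.det_fin_two_of, div_mul_cancel₀ c hz, h.mul_eq, sub_self]
  have htr : !![c / z, U₀; V₀, z].trace = z + c / z := by
    rw [Matrix.trace_fin_two_of, add_comm]
  have htr₀ : z + c / z ≠ 0 := fun h₀ => hzc <| by
    rw [eq_neg_iff_add_eq_zero]
    calc z ^ 2 + c = z * (z + c / z) := by field_simp
      _ = 0 := by rw [h₀, mul_zero]
  have kernel : !![c / z, U₀; V₀, z] *ᵥ ![1, -V₀ / z] = 0 := by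
    ext i
    fin_cases i <;> simp [← h.mul_eq] <;> field_simp <;> ring
  have unique := existsUnique_hasDerivAt_mulVec (κ := κ₀ * (z - c / z)) hPc hP hdet
    (htr ▸ htr₀) (htr ▸ hre) kernel
  exact (existsUnique_congr fun w => ⟨fun hw => ⟨hw.1, hw.2⟩, fun hw => ⟨hw.1, hw.2⟩⟩).1 unique

section Gauge

/-- The exponent `∫_{-∞}^x (c - U V)` of the gauge that removes the diagonal term which does not
decay as `z → ∞`. -/
def gaugeExponent (c : ℂ) (U V : ℝ → ℂ) (x : ℝ) : ℂ := ∫ y in Set.Iic x, (c - U y * V y)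

/-- The upper right coefficient of the gauged system. -/
def gaugedFst (c κ : ℂ) (U V : ℝ → ℂ) (x : ℝ) : ℂ :=
  κ * U x * Complex.exp (-(2 * κ * gaugeExponent c U V x))

/-- The lower left coefficient of the gauged system. -/
def gaugedSnd (c κ : ℂ) (U V : ℝ → ℂ) (x : ℝ) : ℂ :=
  (deriv V x + κ * V x * (c - U x * V x)) * Complex.exp (2 * κ * gaugeExponent c U V x)

theorem IsPotential.hasDerivAt_gaugeExponent (h : IsPotential c U V U₀ V₀) (x : ℝ) :
    HasDerivAt (gaugeExponent c U V) (c - U x * V x) x :=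
  hasDerivAt_setIntegral_Iic h.continuous_defect h.integrableOn_defect x

theorem IsPotential.continuous_gaugeExponent (h : IsPotential c U V U₀ V₀) :
    Continuous (gaugeExponent c U V) :=
  continuous_setIntegral_Iic h.continuous_defect h.integrableOn_defect

theorem tendsto_gaugeExponent (c : ℂ) (U V : ℝ → ℂ) :
    Tendsto (gaugeExponent c U V) atBot (𝓝 0) :=
  tendsto_integral_Iic_zero (f := fun y => c - U y * V y) tendsto_id

theorem IsPotential.hasDerivAt_gaugedFst (h : IsPotential c U V U₀ V₀) (κ : ℂ) (x : ℝ) :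
    HasDerivAt (gaugedFst c κ U V)
      (κ * (deriv U x - 2 * κ * (c - U x * V x) * U x)
        * Complex.exp (-(2 * κ * gaugeExponent c U V x))) x := by
  refine (((h.fst.differentiable x).hasDerivAt.const_mul κ).fun_mul
    ((h.hasDerivAt_gaugeExponent x).const_mul (2 * κ)).fun_neg.cexp).congr_deriv ?_
  ring

theorem IsReduced.hasDerivAt_components (hw : IsReduced c κ₀ U V V₀ z w) (hz : z ≠ 0) {κ : ℂ}
    (hκ : κ * z = κ₀ * (z - c / z)) (x : ℝ) :
    HasDerivAt (fun x => w x 0) (κ * (c * w x 0 + z * U x * w x 1)) x ∧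
      HasDerivAt (fun x => w x 1) (κ * z * (V x * w x 0 + z * w x 1)) x := by
  have h := hasDerivAt_pi.1 (hw.hasDerivAt x)
  rw [← hκ] at h
  refine ⟨(h 0).congr_deriv ?_, (h 1).congr_deriv ?_⟩
  · simp only [Matrix.cons_mulVec, dotProduct, Fin.sum_univ_two, Fin.isValue,
      Matrix.cons_val_zero, Matrix.cons_val_one, Matrix.cons_val_fin_one, Matrix.empty_mulVec,
      Pi.smul_apply, smul_eq_mul]
    field_simp
  · simp [dotProduct]

theorem IsReduced.isOffDiagonal (hw : IsReduced c κ₀ U V V₀ z w) (h : IsPotential c U V U₀ V₀)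
    (hz : z ≠ 0) {κ : ℂ} (hκ : κ * z = κ₀ * (z - c / z)) :
    IsOffDiagonal (κ * (z ^ 2 + c)) (gaugedFst c κ U V) (gaugedSnd c κ U V)
      (fun x => Complex.exp (-(κ * gaugeExponent c U V x)) * w x 0)
      (fun x => Complex.exp (κ * gaugeExponent c U V x) * (z * w x 1 + V x * w x 0)) where
  hasDerivAt_fst x := by
    refine (((h.hasDerivAt_gaugeExponent x).const_mul κ).fun_neg.cexp.fun_mul
      (hw.hasDerivAt_components hz hκ x).1).congr_deriv ?_
    have exp_split : Complex.exp (-(κ * gaugeExponent c U V x))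
        = Complex.exp (-(2 * κ * gaugeExponent c U V x))
          * Complex.exp (κ * gaugeExponent c U V x) := by
      rw [← Complex.exp_add]
      ring_nf
    rw [gaugedFst, exp_split]
    ring
  hasDerivAt_snd x := by
    obtain ⟨hw₀, hw₁⟩ := hw.hasDerivAt_components hz hκ x
    refine (((h.hasDerivAt_gaugeExponent x).const_mul κ).cexp.fun_mul ((hw₁.const_mul z).fun_add
      ((h.snd.differentiable x).hasDerivAt.fun_mul hw₀))).congr_deriv ?_
    have exp_split : Complex.exp (κ * gaugeExponent c U V x)
        = Complex.exp (2 * κ * gaugeExponent c U V x)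
          * Complex.exp (-(κ * gaugeExponent c U V x)) := by
      rw [← Complex.exp_add]
      ring_nf
    rw [gaugedSnd, exp_split]
    ring
  tendsto_fst := by
    have hw₀ : Tendsto (fun x => w x 0) atBot (𝓝 1) := tendsto_pi_nhds.1 hw.tendsto 0
    simpa using ((tendsto_gaugeExponent c U V).const_mul κ).neg.cexp.mul hw₀
  tendsto_snd := by
    have hw₀ : Tendsto (fun x => w x 0) atBot (𝓝 1) := tendsto_pi_nhds.1 hw.tendsto 0
    have hw₁ : Tendsto (fun x => w x 1) atBot (𝓝 (-V₀ / z)) := tendsto_pi_nhds.1 hw.tendsto 1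
    simpa [mul_div_cancel₀ _ hz] using ((tendsto_gaugeExponent c U V).const_mul κ).cexp.mul
      ((hw₁.const_mul z).add (h.snd.tendsto.mul hw₀))

theorem IsPotential.exists_norm_le (h : IsPotential c U V U₀ V₀) (R X : ℝ) :
    ∃ D, ∀ κ : ℂ, ‖κ‖ ≤ R → ‖κ‖ ≤ D ∧ ∀ x ≤ X, ‖U x‖ ≤ D ∧ ‖V x‖ ≤ D ∧
      ‖Complex.exp (2 * κ * gaugeExponent c U V x)‖ ≤ D ∧
      ‖Complex.exp (-(2 * κ * gaugeExponent c U V x))‖ ≤ D := by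
  obtain ⟨DU, hU⟩ := h.fst.exists_norm_le X
  obtain ⟨DV, hV⟩ := h.snd.exists_norm_le X
  obtain ⟨DN, hN⟩ := exists_forall_le_norm_le_of_tendsto_atBot h.continuous_gaugeExponent
    (tendsto_gaugeExponent c U V) X
  refine ⟨max (max R (Real.exp (2 * R * DN))) (max DU DV), fun κ hκ =>
    ⟨hκ.trans (by simp), fun x hx => ⟨(hU x hx).trans (by simp), (hV x hx).trans (by simp), ?_⟩⟩⟩
  have exponent_le : ‖2 * κ * gaugeExponent c U V x‖ ≤ 2 * R * DN :=
    norm_mul_le_of_le (norm_mul_le_of_le (Complex.norm_ofNat 2).le hκ) (hN x hx)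
  refine ⟨(Complex.norm_exp_le_exp_norm _).trans ?_, (Complex.norm_exp_le_exp_norm _).trans ?_⟩
  · exact (Real.exp_le_exp.2 exponent_le).trans (by simp)
  · exact (Real.exp_le_exp.2 ((norm_neg _).trans_le exponent_le)).trans (by simp)

theorem IsPotential.exists_isDominated (h : IsPotential c U V U₀ V₀) (R X : ℝ) :
    ∃ C m, ∀ κ : ℂ, ‖κ‖ ≤ R → IsDominated (gaugedFst c κ U V) (gaugedSnd c κ U V) X C m := by
  obtain ⟨D, hD⟩ := h.exists_norm_le R X
  have hq := h.integrableOn_defect X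
  have hU' : IntegrableOn (deriv U) (Set.Iic X) := h.fst.integrable_deriv.integrableOn
  have hV' : IntegrableOn (deriv V) (Set.Iic X) := h.snd.integrable_deriv.integrableOn
  refine ⟨D * D * D, fun x => D * (‖deriv U x‖ + 2 * D * ‖c - U x * V x‖ * D) * D
    + (‖deriv V x‖ + D * D * ‖c - U x * V x‖) * D, fun κ hκ => ?_⟩
  obtain ⟨κ_le, bounds⟩ := hD κ hκ
  have hD₀ : 0 ≤ D := (norm_nonneg κ).trans κ_le
  exact
  { differentiable := fun x => (h.hasDerivAt_gaugedFst κ x).differentiableAt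
    aestronglyMeasurable := by
      have := h.snd.differentiable.continuous
      have := h.continuous_defect
      have := h.continuous_gaugeExponent
      exact ((measurable_deriv V).aestronglyMeasurable.add (by fun_prop)).mul (by fun_prop)
    norm_fst_le := fun x hx => by
      obtain ⟨U_le, -, -, exp_neg_le⟩ := bounds x hx
      exact norm_mul_le_of_le (norm_mul_le_of_le κ_le U_le) exp_neg_le
    norm_deriv_le := fun x hx => by
      obtain ⟨U_le, -, -, exp_neg_le⟩ := bounds x hx
      rw [(h.hasDerivAt_gaugedFst κ x).deriv]
      refine le_add_of_le_of_nonneg (norm_mul_le_of_le (norm_mul_le_of_le κ_le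
        (norm_sub_le_of_le le_rfl ?_)) exp_neg_le) (by positivity)
      exact norm_mul_le_of_le (norm_mul_le_of_le
        (norm_mul_le_of_le (Complex.norm_ofNat 2).le κ_le) le_rfl) U_le
    norm_snd_le := fun x hx => by
      obtain ⟨-, V_le, exp_le, -⟩ := bounds x hx
      exact le_add_of_nonneg_of_le (by positivity) (norm_mul_le_of_le (norm_add_le_of_le le_rfl
        (norm_mul_le_of_le (norm_mul_le_of_le κ_le V_le) le_rfl)) exp_le)
    integrableOn_bound :=
      (((hU'.norm.add ((hq.norm.const_mul (2 * D)).mul_const D)).const_mul D).mul_const D).add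
        ((hV'.norm.add (hq.norm.const_mul (D * D))).mul_const D) }

end Gauge

end Reduced

section LargeParameter

variable {c κ₀ : ℂ} {l : Filter ℂ} (hl : l ≤ Bornology.cobounded ℂ)

/-- The rate `κ(z)` in `κ(z) z = κ₀ (z - c / z)`. -/
def gaugeRate (c κ₀ z : ℂ) : ℂ := κ₀ * (1 - c * z⁻¹ ^ 2)

theorem gaugeRate_mul_self {z : ℂ} (hz : z ≠ 0) : gaugeRate c κ₀ z * z = κ₀ * (z - c / z) := by
  rw [gaugeRate]
  field_simp

theorem gaugeRate_mul_sq_add {z : ℂ} (hz : z ≠ 0) :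
    gaugeRate c κ₀ z * (z ^ 2 + c) = κ₀ * (z - c / z) * (z + c / z) := by
  rw [← gaugeRate_mul_self hz]
  field_simp

include hl

variable (c κ₀) in
theorem tendsto_gaugeRate : Tendsto (gaugeRate c κ₀) l (𝓝 κ₀) := by
  have hinv : Tendsto (fun z : ℂ => z⁻¹) l (𝓝 0) := tendsto_inv₀_cobounded.mono_left hl
  unfold gaugeRate
  simpa using (((hinv.pow 2).const_mul c).const_sub 1).const_mul κ₀

theorem eventually_norm_gaugeRate_le : ∀ᶠ z in l, ‖gaugeRate c κ₀ z‖ ≤ ‖κ₀‖ + 1 :=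
  ((tendsto_gaugeRate c κ₀ hl).norm.eventually (gt_mem_nhds (lt_add_one _))).mono fun _ hz => hz.le

theorem eventually_re_gaugeRate_mul_sq_add_nonpos
    (hre : ∀ᶠ z in l, (κ₀ * (z - c / z) * (z + c / z)).re ≤ 0) :
    ∀ᶠ z in l, (gaugeRate c κ₀ z * (z ^ 2 + c)).re ≤ 0 := by
  filter_upwards [hre, hl (Bornology.eventually_ne_cobounded 0)] with z hre hz
  rwa [gaugeRate_mul_sq_add hz]

theorem isTheta_gaugeRate_mul_sq_add (hκ₀ : κ₀ ≠ 0) :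
    (fun z => gaugeRate c κ₀ z * (z ^ 2 + c)) =Θ[l] fun z => z ^ 2 := by
  have hinv : Tendsto (fun z : ℂ => z⁻¹) l (𝓝 0) := tendsto_inv₀_cobounded.mono_left hl
  have ratio : Tendsto (fun z => gaugeRate c κ₀ z * (1 + c * z⁻¹ ^ 2)) l (𝓝 κ₀) := by
    simpa using (tendsto_gaugeRate c κ₀ hl).mul (((hinv.pow 2).const_mul c).const_add 1)
  refine (isTheta_of_div_tendsto_nhds_ne_zero (c := κ₀) (ratio.congr' ?_) hκ₀).symm
  filter_upwards [hl (Bornology.eventually_ne_cobounded 0)] with z hz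
  field_simp

theorem tendsto_norm_gaugeRate_mul_sq_add (hκ₀ : κ₀ ≠ 0) :
    Tendsto (fun z => ‖gaugeRate c κ₀ z * (z ^ 2 + c)‖) l atTop := by
  refine (isTheta_gaugeRate_mul_sq_add hl hκ₀).tendsto_norm_atTop_iff.2 ?_
  simpa only [Function.comp_def, norm_pow] using
    (tendsto_pow_atTop two_ne_zero).comp (tendsto_norm_cobounded_atTop.mono_left hl)

theorem isBigO_inv_gaugeRate_mul_sq_add (hκ₀ : κ₀ ≠ 0) :
    (fun z => (gaugeRate c κ₀ z * (z ^ 2 + c))⁻¹) =O[l] fun z => z⁻¹ := by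
  have hinv : Tendsto (fun z : ℂ => z⁻¹) l (𝓝 0) := tendsto_inv₀_cobounded.mono_left hl
  refine (isTheta_gaugeRate_mul_sq_add hl hκ₀).inv.1.trans ?_
  simpa [sq] using (hinv.isBigO_one ℂ).mul (isBigO_refl (fun z : ℂ => z⁻¹) l)

variable (c κ₀) in
theorem isBigO_exp_gaugeRate_mul_sub (N : ℂ) :
    (fun z => Complex.exp (gaugeRate c κ₀ z * N) - Complex.exp (κ₀ * N)) =O[l] fun z => z⁻¹ := by
  have smooth : DifferentiableAt ℂ (fun r : ℂ => Complex.exp (κ₀ * (1 - c * r ^ 2) * N)) 0 := by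
    fun_prop
  simpa [Function.comp_def, gaugeRate] using
    smooth.isBigO_sub.comp_tendsto (tendsto_inv₀_cobounded.mono_left hl)

variable {U V : ℝ → ℂ} {U₀ V₀ : ℂ} {w : ℂ → ℝ → Fin 2 → ℂ} (h : IsPotential c U V U₀ V₀)
  (hκ₀ : κ₀ ≠ 0) (hw : ∀ᶠ z in l, IsReduced c κ₀ U V V₀ z (w z))

include h hw

theorem eventually_isOffDiagonal : ∀ᶠ z in l, IsOffDiagonal (gaugeRate c κ₀ z * (z ^ 2 + c))
    (gaugedFst c (gaugeRate c κ₀ z) U V) (gaugedSnd c (gaugeRate c κ₀ z) U V)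
    (fun x => Complex.exp (-(gaugeRate c κ₀ z * gaugeExponent c U V x)) * w z x 0)
    (fun x => Complex.exp (gaugeRate c κ₀ z * gaugeExponent c U V x)
      * (z * w z x 1 + V x * w z x 0)) := by
  filter_upwards [hw, hl (Bornology.eventually_ne_cobounded 0)] with z hw hz
  exact hw.isOffDiagonal h hz (gaugeRate_mul_self hz)

include hκ₀

variable (hre : ∀ᶠ z in l, (κ₀ * (z - c / z) * (z + c / z)).re ≤ 0)

include hre

theorem isBigO_gauged_sub_one (x : ℝ) :
    (fun z => Complex.exp (-(gaugeRate c κ₀ z * gaugeExponent c U V x)) * w z x 0 - 1)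
      =O[l] fun z => z⁻¹ := by
  obtain ⟨C, m, dominated⟩ := h.exists_isDominated (‖κ₀‖ + 1) x
  exact (IsOffDiagonal.isBigO_fst_sub_one (eventually_isOffDiagonal hl h hw)
    ((eventually_norm_gaugeRate_le hl).mono fun z hz => dominated _ hz)
    (eventually_re_gaugeRate_mul_sq_add_nonpos hl hre)
    (tendsto_norm_gaugeRate_mul_sq_add hl hκ₀) le_rfl).trans
    (isBigO_inv_gaugeRate_mul_sq_add hl hκ₀)

theorem tendsto_gauged_zero [l.IsCountablyGenerated] (x : ℝ) :
    Tendsto (fun z => Complex.exp (gaugeRate c κ₀ z * gaugeExponent c U V x)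
      * (z * w z x 1 + V x * w z x 0)) l (𝓝 0) := by
  obtain ⟨C, m, dominated⟩ := h.exists_isDominated (‖κ₀‖ + 1) x
  have limit_dominated := dominated κ₀ (le_add_of_nonneg_right zero_le_one)
  refine IsOffDiagonal.tendsto_snd_zero (eventually_isOffDiagonal hl h hw)
    ((eventually_norm_gaugeRate_le hl).mono fun z hz => dominated _ hz)
    (eventually_re_gaugeRate_mul_sq_add_nonpos hl hre)
    (tendsto_norm_gaugeRate_mul_sq_add hl hκ₀) (β₀ := gaugedSnd c κ₀ U V)
    (limit_dominated.integrableOn_bound.mono' limit_dominated.aestronglyMeasurable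
      (ae_restrict_of_forall_mem measurableSet_Iic limit_dominated.norm_snd_le)) fun y _ => ?_
  have hκ := tendsto_gaugeRate c κ₀ hl
  exact (((hκ.mul_const (V y)).mul_const _).const_add _).mul
    (((hκ.const_mul 2).mul_const _).cexp)

theorem isBigO_fst_sub_exp (x : ℝ) :
    (fun z => w z x 0 - Complex.exp (κ₀ * gaugeExponent c U V x)) =O[l] fun z => z⁻¹ := by
  have exp_lim := ((tendsto_gaugeRate c κ₀ hl).mul_const
    (gaugeExponent c U V x)).cexp
  have ungauged := (exp_lim.isBigO_one ℂ).mul (isBigO_gauged_sub_one hl h hκ₀ hw hre x)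
  simp only [one_mul] at ungauged
  have exp_sub := isBigO_exp_gaugeRate_mul_sub c κ₀ hl (gaugeExponent c U V x)
  refine (ungauged.add exp_sub).congr_left fun z => ?_
  rw [mul_sub, ← mul_assoc, ← Complex.exp_add, add_neg_cancel, Complex.exp_zero]
  ring

theorem tendsto_mul_snd_add [l.IsCountablyGenerated] (x : ℝ) :
    Tendsto (fun z => z * w z x 1 + V x * w z x 0) l (𝓝 0) := by
  have exp_lim := ((tendsto_gaugeRate c κ₀ hl).mul_const
    (gaugeExponent c U V x)).neg.cexp
  have ungauged := exp_lim.mul (tendsto_gauged_zero hl h hκ₀ hw hre x)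
  rw [mul_zero] at ungauged
  refine ungauged.congr fun z => ?_
  rw [← mul_assoc, ← Complex.exp_add, neg_add_cancel, Complex.exp_zero, one_mul]

theorem isBigO_snd [l.IsCountablyGenerated] (x : ℝ) :
    (fun z => w z x 1) =O[l] fun z => z⁻¹ := by
  have fst_lim : Tendsto (fun z => w z x 0) l (𝓝 (Complex.exp (κ₀ * gaugeExponent c U V x))) :=
    tendsto_sub_nhds_zero_iff.1 ((isBigO_fst_sub_exp hl h hκ₀ hw hre x).trans_tendsto
      (tendsto_inv₀_cobounded.mono_left hl))
  have bounded : (fun z => z * w z x 1) =O[l] fun _ => (1 : ℂ) := by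
    simpa using ((tendsto_mul_snd_add hl h hκ₀ hw hre x).isBigO_one ℂ).sub
      ((fst_lim.const_mul (V x)).isBigO_one ℂ)
  refine (bounded.mul (isBigO_refl (fun z : ℂ => z⁻¹) l)).congr' ?_
    (Eventually.of_forall fun z => one_mul _)
  filter_upwards [hl (Bornology.eventually_ne_cobounded 0)] with z hz
  field_simp

end LargeParameter

section Background

theorem IsProfile.conj {f : ℝ → ℂ} {f₀ : ℂ} (h : IsProfile f f₀) :
    IsProfile (fun x => (starRingEnd ℂ) (f x)) ((starRingEnd ℂ) f₀) where
  differentiable := Complex.conjCLE.differentiable.comp h.differentiable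
  integrable_deriv := by
    have deriv_conj : deriv (fun x => (starRingEnd ℂ) (f x)) =
        fun x => (starRingEnd ℂ) (deriv f x) :=
      funext fun x => (Complex.conjCLE.hasFDerivAt.comp_hasDerivAt x
        (h.differentiable x).hasDerivAt).deriv
    rw [deriv_conj]
    exact Complex.conjCLE.toContinuousLinearMap.integrable_comp h.integrable_deriv
  tendsto := (Complex.continuous_conj.tendsto f₀).comp h.tendsto
  integrableOn_sub x := by
    simpa [IntegrableOn] using
      Complex.conjCLE.toContinuousLinearMap.integrable_comp (h.integrableOn_sub x)

theorem integrableOn_Iic_of_continuous {f : ℝ → ℂ} (hf : Continuous f) {a : ℝ}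
    (h : IntegrableOn f (Set.Iic a)) (x : ℝ) : IntegrableOn f (Set.Iic x) :=
  (h.union (hf.integrableOn_Icc (a := a) (b := x))).mono_set fun y hy =>
    (le_total y a).imp id fun hya => ⟨hya, hy⟩

/-- The orientation `±1` of the line that carries an end to `-∞`. -/
def Side.sign : Side → ℝ
  | Side.minus => 1
  | Side.plus => -1

theorem Side.sign_mul_sign (s : Side) : s.sign * s.sign = 1 := by
  cases s <;> norm_num [Side.sign]

theorem Side.map_sign_mul_atBot (s : Side) : map (fun x => s.sign * x) atBot = s.atEnd := by
  cases s with
  | minus => simp only [Side.sign, Side.atEnd, one_mul, map_id']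
  | plus =>
    simp only [Side.sign, Side.atEnd, neg_one_mul]
    exact map_neg_atBot

/-- The assumptions on the potential at a fixed time: `v` has the limits `uInf s`, of modulus `u₀`,
at the two ends, approaches them in `L¹`, and has an integrable derivative. -/
structure HasBackground (u₀ : ℝ) (uInf : Side → ℂ) (v : ℝ → ℂ) : Prop where
  norm_eq : ∀ s, ‖uInf s‖ = u₀
  differentiable : Differentiable ℝ v
  tendsto : ∀ s, Tendsto v (Side.atEnd s) (𝓝 (uInf s))
  integrableOn_sub : ∀ s, IntegrableOn (fun x => v x - uInf s) (Side.halfLine s)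
  integrable_deriv : Integrable (deriv v)

variable {u₀ : ℝ} {uInf : Side → ℂ} {v : ℝ → ℂ}

theorem HasBackground.isProfile (h : HasBackground u₀ uInf v) (s : Side) :
    IsProfile (fun x => v (s.sign * x)) (uInf s) := by
  have hdiff : Differentiable ℝ fun x => v (s.sign * x) :=
    h.differentiable.comp (differentiable_id.const_mul _)
  have sub_integrableOn : IntegrableOn (fun x => v (s.sign * x) - uInf s) (Set.Iic 0) := by
    cases s with
    | minus => simpa only [Side.sign, one_mul, Side.halfLine] using h.integrableOn_sub .minus
    | plus =>
      have reflected := (h.integrableOn_sub .plus).comp_neg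
      simpa only [Side.sign, neg_one_mul, Side.halfLine, Set.neg_Ici, neg_zero] using reflected
  refine ⟨hdiff, ?_, (h.tendsto s).comp s.map_sign_mul_atBot.le,
    integrableOn_Iic_of_continuous (hdiff.continuous.sub continuous_const) sub_integrableOn⟩
  have chain_rule : deriv (fun x => v (s.sign * x)) = s.sign • fun x => deriv v (s.sign * x) :=
    funext fun x => deriv_comp_mul_left s.sign v x
  rw [chain_rule]
  exact (h.integrable_deriv.comp_mul_left' (left_ne_zero_of_mul_eq_one s.sign_mul_sign)).smul _

theorem potQ_mul_potQ_rev (v : ℂ) (j : Fin 2) :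
    potQ v j j.rev * potQ v j.rev j = (‖v‖ : ℂ) ^ 2 := by
  fin_cases j
  · exact Complex.mul_conj' v
  · exact Complex.conj_mul' v

theorem HasBackground.isPotential (h : HasBackground u₀ uInf v) (s : Side) (j : Fin 2) :
    IsPotential ((u₀ : ℂ) ^ 2) (fun x => potQ (v (s.sign * x)) j j.rev)
      (fun x => potQ (v (s.sign * x)) j.rev j) (potQ (uInf s) j j.rev)
      (potQ (uInf s) j.rev j) := by
  have mul_eq : potQ (uInf s) j j.rev * potQ (uInf s) j.rev j = (u₀ : ℂ) ^ 2 := by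
    rw [potQ_mul_potQ_rev, h.norm_eq]
  fin_cases j
  · exact ⟨h.isProfile s, (h.isProfile s).conj, mul_eq⟩
  · exact ⟨(h.isProfile s).conj, h.isProfile s, mul_eq⟩

theorem sq_sub_potQ_mul_potQ_rev (u₀ : ℝ) (v : ℂ) (j : Fin 2) :
    (u₀ : ℂ) ^ 2 - potQ v j j.rev * potQ v j.rev j = ((u₀ ^ 2 - ‖v‖ ^ 2 : ℝ) : ℂ) := by
  rw [potQ_mul_potQ_rev]
  push_cast
  rfl

theorem HasBackground.integrableOn_Iic (h : HasBackground u₀ uInf v) (s : Side) (x : ℝ) :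
    IntegrableOn (fun y => u₀ ^ 2 - ‖v (s.sign * y)‖ ^ 2) (Set.Iic x) := by
  have complex_valued := (h.isPotential s 0).integrableOn_defect x
  simp only [sq_sub_potQ_mul_potQ_rev] at complex_valued
  exact complex_valued.re

theorem HasBackground.integrableOn_defect (h : HasBackground u₀ uInf v) (x : ℝ) :
    IntegrableOn (fun y => u₀ ^ 2 - ‖v y‖ ^ 2) (Set.Iic x) ∧
      IntegrableOn (fun y => u₀ ^ 2 - ‖v y‖ ^ 2) (Set.Ici x) := by
  refine ⟨by simpa only [Side.sign, one_mul] using h.integrableOn_Iic .minus x, ?_⟩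
  have reflected := (h.integrableOn_Iic .plus (-x)).comp_neg
  simpa only [Side.sign, neg_one_mul, neg_neg, Set.neg_Iic] using reflected

end Background

section Substitution

variable {n : Type*} [Fintype n]

/-- The change of unknown by a constant matrix `T`, the dilation `ε` of the line (`ε = ±1` in the
application) and the scalar factor `e^{γ x + δ}`. -/
def substitution (T : Matrix n n ℂ) (ε : ℝ) (γ δ : ℂ) (f : ℝ → n → ℂ) (x : ℝ) : n → ℂ :=
  Complex.exp (γ * (ε * x : ℝ) + δ) • (T *ᵥ f (ε * x))

theorem hasDerivAt_substitution {T : Matrix n n ℂ} {ε : ℝ} {γ δ : ℂ} {A B : ℝ → Matrix n n ℂ}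
    (hB : ∀ x, B x * T = (ε : ℂ) • (γ • T + T * A (ε * x))) {f : ℝ → n → ℂ}
    (hf : ∀ x, HasDerivAt f (A x *ᵥ f x) x) (x : ℝ) :
    HasDerivAt (substitution T ε γ δ f) (B x *ᵥ substitution T ε γ δ f x) x := by
  classical
  have factor : HasDerivAt (fun y : ℝ => Complex.exp (γ * y + δ))
      (Complex.exp (γ * (ε * x : ℝ) + δ) * (γ * 1)) (ε * x) :=
    (((hasDerivAt_id (ε * x)).ofReal_comp.const_mul γ).add_const δ).cexp
  have image : HasDerivAt (fun y => T *ᵥ f y) (T *ᵥ (A (ε * x) *ᵥ f (ε * x))) (ε * x) :=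
    ((mulVecCLM T).restrictScalars ℝ).hasFDerivAt.comp_hasDerivAt (ε * x) (hf (ε * x))
  refine ((factor.fun_smul image).scomp x ((hasDerivAt_id x).const_mul ε)).congr_deriv ?_
  rw [substitution, Matrix.mulVec_smul, Matrix.mulVec_mulVec _ (B x), hB x, Matrix.smul_mulVec,
    Matrix.add_mulVec, Matrix.smul_mulVec, Matrix.mulVec_mulVec, mul_one, ← Complex.coe_smul]
  module

variable [DecidableEq n] {T : (Matrix n n ℂ)ˣ} {ε : ℝ}

theorem substitution_inv_substitution (hε : ε * ε = 1) (T : (Matrix n n ℂ)ˣ) (γ δ : ℂ)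
    (f : ℝ → n → ℂ) :
    substitution (T⁻¹).1 ε (-(ε * γ)) (-δ) (substitution T.1 ε γ δ f) = f := by
  have hεC : (ε : ℂ) * ε = 1 := mod_cast hε
  funext x
  have factor : Complex.exp (-(ε * γ) * (ε * x : ℝ) + -δ) * Complex.exp (γ * (x : ℝ) + δ) = 1 := by
    rw [← Complex.exp_add, Complex.exp_eq_one_iff]
    refine ⟨0, ?_⟩
    push_cast
    linear_combination -γ * x * hεC
  simp only [substitution, ← mul_assoc ε, hε, one_mul, Matrix.mulVec_smul, Matrix.mulVec_mulVec,
    Units.inv_mul, Matrix.one_mulVec, smul_smul, factor, one_smul]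

theorem substitution_substitution_inv (hε : ε * ε = 1) (T : (Matrix n n ℂ)ˣ) (γ δ : ℂ)
    (w : ℝ → n → ℂ) :
    substitution T.1 ε γ δ (substitution (T⁻¹).1 ε (-(ε * γ)) (-δ) w) = w := by
  have hεC : (ε : ℂ) * ε = 1 := mod_cast hε
  have involutive := substitution_inv_substitution hε T⁻¹ (-(ε * γ)) (-δ) w
  rwa [inv_inv, mul_neg, neg_neg, neg_neg, ← mul_assoc, hεC, one_mul] at involutive

theorem hasDerivAt_substitution_iff (hε : ε * ε = 1) {γ δ : ℂ} {A B : ℝ → Matrix n n ℂ}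
    (hB : ∀ x, B x * T = (ε : ℂ) • (γ • T.1 + T * A (ε * x))) {f : ℝ → n → ℂ} :
    (∀ x, HasDerivAt (substitution T.1 ε γ δ f) (B x *ᵥ substitution T.1 ε γ δ f x) x) ↔
      ∀ x, HasDerivAt f (A x *ᵥ f x) x := by
  have hεC : (ε : ℂ) * ε = 1 := mod_cast hε
  have hA : ∀ x, A x * T⁻¹.1 = (ε : ℂ) • (-(ε * γ) • T⁻¹.1 + T⁻¹.1 * B (ε * x)) := fun x => by
    have conjugated : T⁻¹.1 * B (ε * x) = (ε : ℂ) • (γ • T⁻¹.1 + A x * T⁻¹.1) := by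
      have h := congrArg (fun M => T⁻¹.1 * M * T⁻¹.1) (hB (ε * x))
      simpa only [← mul_assoc ε, hε, one_mul, mul_assoc, Units.mul_inv, mul_one, mul_smul_comm,
        smul_mul_assoc, mul_add, add_mul, Units.inv_mul_cancel_left] using h
    calc A x * T⁻¹.1
        = (-((ε * ε : ℂ) * γ) + (ε * ε : ℂ) * γ) • T⁻¹.1 + (ε * ε : ℂ) • (A x * T⁻¹.1) := by
          rw [hεC]
          module
      _ = (ε : ℂ) • (-(ε * γ) • T⁻¹.1 + T⁻¹.1 * B (ε * x)) := by
          rw [conjugated]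
          module
  refine ⟨fun hw => ?_, fun hf => hasDerivAt_substitution hB hf⟩
  rw [← substitution_inv_substitution hε T γ δ f]
  exact hasDerivAt_substitution hA hw

theorem tendsto_units_mulVec_iff {ι : Type*} {l : Filter ι} {g : ι → n → ℂ} {g₀ : n → ℂ} :
    Tendsto (fun x => T.1 *ᵥ g x) l (𝓝 (T.1 *ᵥ g₀)) ↔ Tendsto g l (𝓝 g₀) := by
  refine ⟨fun h => ?_, fun h => ((mulVecCLM T.1).continuous.tendsto g₀).comp h⟩
  have inverse := ((mulVecCLM T⁻¹.1).continuous.tendsto _).comp h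
  simpa only [Function.comp_def, mulVecCLM_apply, Matrix.mulVec_mulVec, Units.inv_mul,
    Matrix.one_mulVec] using inverse

end Substitution

section Columns

/-- The matrix that brings the first and the second column to the common reduced form. -/
def columnMatrix : Fin 2 → (Matrix (Fin 2) (Fin 2) ℂ)ˣ :=
  ![1, ⟨!![0, 1; -1, 0], !![0, -1; 1, 0], by simp [Matrix.one_fin_two],
    by simp [Matrix.one_fin_two]⟩]

/-- The constant `κ₀` of the reduced system of a column. -/
def columnRate (α : ℝ) (s : Side) (j : Fin 2) : ℂ :=
  s.sign * sigma3 j j * (Complex.I / (2 * α))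

/-- The growth rate `± i k λ` of the factor `e^{-iθσ₃}` on a column, as a function of `x`. -/
def phaseRate (α u₀ : ℝ) (z : ℂ) (j : Fin 2) : ℂ :=
  sigma3 j j * (Complex.I * (specK α u₀ z * specLam u₀ z))

/-- The value at `x = 0` of the exponent of the factor `e^{-iθσ₃}` on a column. -/
def phaseShift (α u₀ t : ℝ) (z : ℂ) (j : Fin 2) : ℂ :=
  sigma3 j j * (Complex.I * -phase α u₀ 0 t z)

variable {α u₀ : ℝ} {uInf : Side → ℂ} {u : ℝ → ℝ → ℂ} {s : Side} {j : Fin 2} {z : ℂ}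

theorem expISigma3_diag (a : ℂ) (j : Fin 2) :
    expISigma3 a j j = Complex.exp (sigma3 j j * (Complex.I * a)) := by
  fin_cases j <;> simp [expISigma3, sigma3]

theorem expISigma3_neg_phase_diag (α u₀ x t : ℝ) (z : ℂ) (j : Fin 2) :
    expISigma3 (-phase α u₀ x t z) j j
      = Complex.exp (phaseRate α u₀ z j * x + phaseShift α u₀ t z j) := by
  rw [expISigma3_diag, phaseRate, phaseShift, phase, phase]
  congr 1
  push_cast
  ring

theorem sigma3_diag_ne_zero (j : Fin 2) : sigma3 j j ≠ 0 := by
  fin_cases j <;> simp [sigma3]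

theorem columnRate_ne_zero (hα : 0 < α) (s : Side) (j : Fin 2) : columnRate α s j ≠ 0 := by
  have hα' : (α : ℂ) ≠ 0 := mod_cast hα.ne'
  have hs : (s.sign : ℂ) ≠ 0 := mod_cast left_ne_zero_of_mul_eq_one s.sign_mul_sign
  simp [columnRate, hs, sigma3_diag_ne_zero, hα']

theorem reduced_mul_columnMatrix (hα : 0 < α) (s : Side) (j : Fin 2) (hz : z ≠ 0) (v : ℂ) :
    ((columnRate α s j * (z - (u₀ : ℂ) ^ 2 / z)) •
        !![(u₀ : ℂ) ^ 2 / z, potQ v j j.rev; potQ v j.rev j, z]) * columnMatrix j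
      = (s.sign : ℂ) • (phaseRate α u₀ z j • (columnMatrix j).1
          + columnMatrix j * laxX α u₀ v z) := by
  have hα' : (α : ℂ) ≠ 0 := mod_cast hα.ne'
  fin_cases j <;> ext a b <;> fin_cases a <;> fin_cases b <;>
    simp [columnMatrix, laxX, sigma3, potQ, columnRate, phaseRate, specK, specLam,
      Matrix.mul_apply, Fin.sum_univ_two] <;> field_simp <;> ring

theorem columnMatrix_mulVec_col (M : Matrix (Fin 2) (Fin 2) ℂ) (j : Fin 2) :
    (columnMatrix j).1 *ᵥ M.col j = ![M j j, sigma3 j j * M j.rev j] := by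
  fin_cases j <;> ext i <;> fin_cases i <;> simp [columnMatrix, sigma3, Matrix.mulVec, dotProduct]

theorem columnMatrix_mulVec_eigY (j : Fin 2) (v z : ℂ) :
    (columnMatrix j).1 *ᵥ (eigY v z).col j = ![1, -potQ v j.rev j / z] := by
  rw [columnMatrix_mulVec_col]
  fin_cases j <;> simp [eigY, sigma3, potQ, div_eq_inv_mul]

/-- The unknown of the reduced system that belongs to a Jost column `f`. -/
def reduceColumn (α u₀ t : ℝ) (s : Side) (j : Fin 2) (z : ℂ) :
    (ℝ → Fin 2 → ℂ) ≃ (ℝ → Fin 2 → ℂ) where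
  toFun := substitution (columnMatrix j).1 s.sign (phaseRate α u₀ z j) (phaseShift α u₀ t z j)
  invFun := substitution (columnMatrix j)⁻¹.1 s.sign (-(s.sign * phaseRate α u₀ z j))
    (-phaseShift α u₀ t z j)
  left_inv := substitution_inv_substitution s.sign_mul_sign _ _ _
  right_inv := substitution_substitution_inv s.sign_mul_sign _ _ _

theorem reduceColumn_apply (t : ℝ) (s : Side) (j : Fin 2) (z : ℂ) (f : ℝ → Fin 2 → ℂ) (x : ℝ) :
    reduceColumn α u₀ t s j z f x = (columnMatrix j).1 *ᵥ
      (expISigma3 (-phase α u₀ (s.sign * x) t z) j j • f (s.sign * x)) := by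
  rw [expISigma3_neg_phase_diag, Matrix.mulVec_smul]
  rfl

theorem isJostColumn_iff_isReduced (hα : 0 < α) (s : Side) (t : ℝ) (j : Fin 2) (hz : z ≠ 0)
    (f : ℝ → Fin 2 → ℂ) :
    IsJostColumn α u₀ uInf u s t z j f ↔
      IsReduced ((u₀ : ℂ) ^ 2) (columnRate α s j) (fun x => potQ (u (s.sign * x) t) j j.rev)
        (fun x => potQ (u (s.sign * x) t) j.rev j) (potQ (uInf s) j.rev j) z
        (reduceColumn α u₀ t s j z f) := by
  have equation := hasDerivAt_substitution_iff s.sign_mul_sign (δ := phaseShift α u₀ t z j)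
    (A := fun x => laxX α u₀ (u x t) z) (f := f)
    fun x => reduced_mul_columnMatrix hα s j hz (u (s.sign * x) t)
  have normalization : Tendsto (reduceColumn α u₀ t s j z f) atBot
        (𝓝 ![1, -potQ (uInf s) j.rev j / z]) ↔
      Tendsto (fun x : ℝ => expISigma3 (-phase α u₀ x t z) j j • f x) s.atEnd
        (𝓝 ((eigY (uInf s) z).col j)) := by
    rw [← columnMatrix_mulVec_eigY, funext (reduceColumn_apply t s j z f),
      tendsto_units_mulVec_iff, ← s.map_sign_mul_atBot, tendsto_map'_iff]
    rfl
  simp only [Matrix.smul_mulVec] at equation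
  exact ⟨fun h => ⟨equation.2 h.lax, normalization.2 h.normalized⟩,
    fun h => ⟨equation.1 h.hasDerivAt, normalization.1 h.tendsto⟩⟩

theorem im_sub_div_mul_add_div (c : ℝ) (z : ℂ) :
    ((z - c / z) * (z + c / z)).im = 2 * (1 + c ^ 2 / Complex.normSq z ^ 2) * (z.re * z.im) := by
  have div_eq : (c : ℂ) / z = ((c / Complex.normSq z : ℝ) : ℂ) * (starRingEnd ℂ) z := by
    rw [div_eq_mul_inv, Complex.inv_def]
    push_cast
    ring
  rw [div_eq, ← div_pow]
  simp only [Complex.mul_im, Complex.sub_re, Complex.sub_im, Complex.add_re, Complex.add_im,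
    Complex.mul_re, Complex.ofReal_re, Complex.ofReal_im, Complex.conj_re, Complex.conj_im]
  ring

theorem mem_jostDomain_iff : z ∈ jostDomain u₀ s j ↔
    z ≠ 0 ∧ z ^ 2 ≠ -(u₀ : ℂ) ^ 2 ∧ 0 ≤ s.sign * (sigma3 j j).re * (z.re * z.im) := by
  cases s <;> fin_cases j <;> simp [jostDomain, Side.sign, sigma3]

theorem re_columnRate_mul_nonpos (hα : 0 < α) (hz : z ∈ jostDomain u₀ s j) :
    (columnRate α s j * (z - (u₀ : ℂ) ^ 2 / z) * (z + (u₀ : ℂ) ^ 2 / z)).re ≤ 0 := by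
  obtain ⟨-, -, hsign⟩ := mem_jostDomain_iff.1 hz
  have sigma3_real : sigma3 j j = ((sigma3 j j).re : ℂ) := by
    fin_cases j <;> simp [sigma3]
  have re_eq : (columnRate α s j * (z - (u₀ : ℂ) ^ 2 / z) * (z + (u₀ : ℂ) ^ 2 / z)).re
      = -((1 + (u₀ ^ 2) ^ 2 / Complex.normSq z ^ 2) / α
          * (s.sign * (sigma3 j j).re * (z.re * z.im))) := by
    have factored : columnRate α s j * (z - (u₀ : ℂ) ^ 2 / z) * (z + (u₀ : ℂ) ^ 2 / z)
        = ((s.sign * (sigma3 j j).re / (2 * α) : ℝ) : ℂ)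
          * (Complex.I * ((z - (u₀ ^ 2 : ℝ) / z) * (z + (u₀ ^ 2 : ℝ) / z))) := by
      rw [columnRate, sigma3_real, Complex.ofReal_re]
      push_cast
      ring
    rw [factored, Complex.re_ofReal_mul, Complex.I_mul_re, im_sub_div_mul_add_div]
    ring
  rw [re_eq]
  exact neg_nonpos.2 (mul_nonneg (by positivity) hsign)

theorem existsUnique_isJostColumn (hα : 0 < α) {t : ℝ}
    (h : HasBackground u₀ uInf fun x => u x t) (hz : z ∈ jostDomain u₀ s j) :
    ∃! f : ℝ → Fin 2 → ℂ, IsJostColumn α u₀ uInf u s t z j f := by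
  obtain ⟨hz₀, hz_sq, -⟩ := mem_jostDomain_iff.1 hz
  refine ((reduceColumn α u₀ t s j z).existsUnique_congr fun f =>
    isJostColumn_iff_isReduced hα s t j hz₀ f).2 ?_
  exact existsUnique_isReduced (h.isPotential s j) hz₀ hz_sq (re_columnRate_mul_nonpos hα hz)

end Columns

section Infinity

variable {α u₀ : ℝ} {uInf : Side → ℂ} {u : ℝ → ℝ → ℂ} {s : Side} {j : Fin 2}
  {φ : ℝ → ℝ → ℂ → Matrix (Fin 2) (Fin 2) ℂ} {t : ℝ}

theorem modifiedJost_apply (φ : ℝ → ℝ → ℂ → Matrix (Fin 2) (Fin 2) ℂ) (x t : ℝ) (z : ℂ)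
    (i j : Fin 2) :
    modifiedJost α u₀ φ x t z i j = φ x t z i j * expISigma3 (-phase α u₀ x t z) j j := by
  fin_cases j <;> simp [modifiedJost, expISigma3, Matrix.mul_apply, Fin.sum_univ_two]

theorem reduceColumn_col_jost (s : Side) (j : Fin 2) (φ : ℝ → ℝ → ℂ → Matrix (Fin 2) (Fin 2) ℂ)
    (x t : ℝ) (z : ℂ) :
    reduceColumn α u₀ t s j z (fun x => (φ x t z).col j) (s.sign * x)
      = (columnMatrix j).1 *ᵥ (modifiedJost α u₀ φ x t z).col j := by
  rw [reduceColumn_apply, ← mul_assoc, s.sign_mul_sign, one_mul]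
  congr 1
  ext i
  rw [Matrix.col_apply, modifiedJost_apply, mul_comm]
  rfl

theorem columnRate_mul_gaugeExponent (s : Side) (j : Fin 2) (x t : ℝ) :
    columnRate α s j * gaugeExponent ((u₀ : ℂ) ^ 2) (fun y => potQ (u (s.sign * y) t) j j.rev)
        (fun y => potQ (u (s.sign * y) t) j.rev j) (s.sign * x)
      = sigma3 j j * (Complex.I * (nu α u₀ u s x t : ℂ)) := by
  simp only [gaugeExponent, sq_sub_potQ_mul_potQ_rev]
  rw [integral_complex_ofReal]
  cases s with
  | minus =>
    simp only [Side.sign, one_mul, columnRate, nu]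
    push_cast
    ring
  | plus =>
    have reflected := integral_comp_neg_Iic (-x) fun y => u₀ ^ 2 - ‖u y t‖ ^ 2
    simp only [Side.sign, neg_one_mul, columnRate, nu]
    rw [reflected, neg_neg, integral_Ici_eq_integral_Ioi]
    push_cast
    ring

instance isCountablyGenerated_cobounded : (Bornology.cobounded ℂ).IsCountablyGenerated := by
  rw [← comap_norm_atTop]
  infer_instance

theorem eventually_isReduced (hα : 0 < α) (hφ : IsJost α u₀ uInf u s φ) (j : Fin 2) (t : ℝ) :
    ∀ᶠ z in Bornology.cobounded ℂ ⊓ 𝓟 (jostDomain u₀ s j),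
      IsReduced ((u₀ : ℂ) ^ 2) (columnRate α s j) (fun x => potQ (u (s.sign * x) t) j j.rev)
        (fun x => potQ (u (s.sign * x) t) j.rev j) (potQ (uInf s) j.rev j) z
        (reduceColumn α u₀ t s j z fun x => (φ x t z).col j) := by
  filter_upwards [mem_inf_of_right (mem_principal_self _)] with z hz
  exact (isJostColumn_iff_isReduced hα s t j (mem_jostDomain_iff.1 hz).1 _).1 (hφ j t z hz)

theorem eventually_re_columnRate_mul_nonpos (hα : 0 < α) (u₀ : ℝ) (s : Side) (j : Fin 2) :
    ∀ᶠ z in Bornology.cobounded ℂ ⊓ 𝓟 (jostDomain u₀ s j),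
      (columnRate α s j * (z - (u₀ : ℂ) ^ 2 / z) * (z + (u₀ : ℂ) ^ 2 / z)).re ≤ 0 := by
  filter_upwards [mem_inf_of_right (mem_principal_self _)] with z hz
  exact re_columnRate_mul_nonpos hα hz

theorem expISigma3_rev_diag (a : ℂ) (j : Fin 2) : expISigma3 a j.rev j = 0 := by
  fin_cases j <;> rfl

variable (hα : 0 < α) (h : HasBackground u₀ uInf fun x => u x t) (hφ : IsJost α u₀ uInf u s φ)

include hα h hφ

theorem isBigO_modifiedJost_diag_sub (j : Fin 2) (x : ℝ) :
    (fun z => modifiedJost α u₀ φ x t z j j - expISigma3 (nu α u₀ u s x t : ℂ) j j)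
      =O[Bornology.cobounded ℂ ⊓ 𝓟 (jostDomain u₀ s j)] fun z => z⁻¹ := by
  have reduced := isBigO_fst_sub_exp inf_le_left (h.isPotential s j)
    (columnRate_ne_zero hα s j) (eventually_isReduced hα hφ j t)
    (eventually_re_columnRate_mul_nonpos hα u₀ s j) (s.sign * x)
  simpa only [columnRate_mul_gaugeExponent, ← expISigma3_diag, reduceColumn_col_jost,
    columnMatrix_mulVec_col, Matrix.cons_val_zero] using reduced

theorem isBigO_modifiedJost_rev_diag (j : Fin 2) (x : ℝ) :
    (fun z => modifiedJost α u₀ φ x t z j.rev j)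
      =O[Bornology.cobounded ℂ ⊓ 𝓟 (jostDomain u₀ s j)] fun z => z⁻¹ := by
  have reduced := isBigO_snd inf_le_left (h.isPotential s j)
    (columnRate_ne_zero hα s j) (eventually_isReduced hα hφ j t)
    (eventually_re_columnRate_mul_nonpos hα u₀ s j) (s.sign * x)
  simp only [reduceColumn_col_jost, columnMatrix_mulVec_col, Matrix.cons_val_one,
    Matrix.cons_val_fin_one] at reduced
  exact (isBigO_const_mul_left_iff (sigma3_diag_ne_zero j)).1 reduced

theorem isBigO_modifiedJost_sub (i j : Fin 2) (x : ℝ) :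
    (fun z => modifiedJost α u₀ φ x t z i j - expISigma3 (nu α u₀ u s x t : ℂ) i j)
      =O[Bornology.cobounded ℂ ⊓ 𝓟 (jostDomain u₀ s j)] fun z => z⁻¹ := by
  obtain rfl | rfl : i = j ∨ i = j.rev := by decide +revert
  · exact isBigO_modifiedJost_diag_sub hα h hφ i x
  · simpa only [expISigma3_rev_diag, sub_zero] using isBigO_modifiedJost_rev_diag hα h hφ j x

theorem tendsto_mul_modifiedJost_add (j : Fin 2) (x : ℝ) :
    Tendsto (fun z => z * (sigma3 j j * modifiedJost α u₀ φ x t z j.rev j)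
        + potQ (u x t) j.rev j * modifiedJost α u₀ φ x t z j j)
      (Bornology.cobounded ℂ ⊓ 𝓟 (jostDomain u₀ s j)) (𝓝 0) := by
  have reduced := tendsto_mul_snd_add inf_le_left (h.isPotential s j)
    (columnRate_ne_zero hα s j) (eventually_isReduced hα hφ j t)
    (eventually_re_columnRate_mul_nonpos hα u₀ s j) (s.sign * x)
  simpa only [reduceColumn_col_jost, columnMatrix_mulVec_col, Matrix.cons_val_zero,
    Matrix.cons_val_one, Matrix.cons_val_fin_one, ← mul_assoc s.sign, s.sign_mul_sign, one_mul]
    using reduced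

theorem tendsto_expISigma3_mul_modifiedJost (x : ℝ) :
    Tendsto (fun z => (expISigma3 (nu α u₀ u s x t : ℂ) * (z • modifiedJost α u₀ φ x t z)) 0 1)
      (Bornology.cobounded ℂ ⊓ 𝓟 (jostDomain u₀ s 1)) (𝓝 (u x t)) := by
  set a : ℂ := (nu α u₀ u s x t : ℂ)
  have diag : Tendsto (fun z => modifiedJost α u₀ φ x t z 1 1)
      (Bornology.cobounded ℂ ⊓ 𝓟 (jostDomain u₀ s 1)) (𝓝 (expISigma3 a 1 1)) :=
    tendsto_sub_nhds_zero_iff.1 ((isBigO_modifiedJost_diag_sub hα h hφ 1 x).trans_tendsto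
      (tendsto_inv₀_cobounded.mono_left inf_le_left))
  have off_diag := ((diag.const_mul (u x t)).sub
    (tendsto_mul_modifiedJost_add hα h hφ 1 x)).const_mul (expISigma3 a 0 0)
  have inverse : expISigma3 a 0 0 * (u x t * expISigma3 a 1 1 - 0) = u x t := by
    rw [sub_zero, mul_left_comm, expISigma3_diag, expISigma3_diag, ← Complex.exp_add]
    simp [sigma3]
  rw [inverse] at off_diag
  refine off_diag.congr fun z => ?_
  simp [expISigma3, sigma3, potQ, Matrix.mul_apply, Fin.sum_univ_two]

end Infinity

section Symmetry

variable {α u₀ : ℝ} {uInf : Side → ℂ} {u : ℝ → ℝ → ℂ} {s : Side} {j : Fin 2} {z : ℂ}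
  {φ : ℝ → ℝ → ℂ → Matrix (Fin 2) (Fin 2) ℂ} {t : ℝ}

theorem specK_neg_sq_div (hu₀ : u₀ ≠ 0) (z : ℂ) :
    specK α u₀ (-(u₀ : ℂ) ^ 2 / z) = specK α u₀ z := by
  have hu : (u₀ : ℂ) ≠ 0 := mod_cast hu₀
  rw [specK, specK]
  congr 1
  field_simp
  ring

theorem specLam_neg_sq_div (hu₀ : u₀ ≠ 0) (z : ℂ) :
    specLam u₀ (-(u₀ : ℂ) ^ 2 / z) = -specLam u₀ z := by
  have hu : (u₀ : ℂ) ≠ 0 := mod_cast hu₀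
  rw [specLam, specLam]
  field_simp
  ring

theorem phase_neg_sq_div (hu₀ : u₀ ≠ 0) (x t : ℝ) (z : ℂ) :
    phase α u₀ x t (-(u₀ : ℂ) ^ 2 / z) = -phase α u₀ x t z := by
  rw [phase, phase, specK_neg_sq_div hu₀, specLam_neg_sq_div hu₀]
  ring

theorem expISigma3_neg_rev (a : ℂ) (j : Fin 2) :
    expISigma3 (-a) j.rev j.rev = expISigma3 a j j := by
  fin_cases j <;> simp [expISigma3]

theorem eigY_smul_col_neg_sq_div (hu₀ : u₀ ≠ 0) {v : ℂ} (hv : ‖v‖ = u₀) (hz : z ≠ 0) (j : Fin 2) :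
    eigY v z j.rev j • (eigY v (-(u₀ : ℂ) ^ 2 / z)).col j.rev = (eigY v z).col j := by
  have hv₀ : v ≠ 0 := norm_ne_zero_iff.1 (hv ▸ hu₀)
  have hv₀' : (starRingEnd ℂ) v ≠ 0 := (map_ne_zero _).2 hv₀
  rw [← hv, ← Complex.mul_conj']
  fin_cases j <;> ext i <;> fin_cases i <;> simp [eigY, sigma3, potQ] <;> field_simp

theorem neg_sq_div_re_mul_im (u₀ : ℝ) (z : ℂ) :
    (-(u₀ : ℂ) ^ 2 / z).re * (-(u₀ : ℂ) ^ 2 / z).im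
      = -((u₀ ^ 2 / Complex.normSq z) ^ 2 * (z.re * z.im)) := by
  have real_mul : -(u₀ : ℂ) ^ 2 / z = ((-u₀ ^ 2 : ℝ) : ℂ) * z⁻¹ := by
    push_cast
    ring
  rw [real_mul, Complex.re_ofReal_mul, Complex.im_ofReal_mul, Complex.inv_re, Complex.inv_im]
  ring

theorem neg_sq_div_mem_jostDomain (hu₀ : u₀ ≠ 0) (hz : z ∈ jostDomain u₀ s j) :
    -(u₀ : ℂ) ^ 2 / z ∈ jostDomain u₀ s j.rev := by
  obtain ⟨hz₀, hz_sq, hsign⟩ := mem_jostDomain_iff.1 hz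
  have hu : (u₀ : ℂ) ^ 2 ≠ 0 := pow_ne_zero 2 (mod_cast hu₀)
  refine mem_jostDomain_iff.2 ⟨div_ne_zero (neg_ne_zero.2 hu) hz₀, fun h => hz_sq ?_, ?_⟩
  · have h_mul : (u₀ : ℂ) ^ 2 * z ^ 2 = (u₀ : ℂ) ^ 2 * -(u₀ : ℂ) ^ 2 := by
      field_simp at h
      linear_combination h
    exact mul_left_cancel₀ hu h_mul
  · have sigma3_rev : (sigma3 j.rev j.rev).re = -(sigma3 j j).re := by
      fin_cases j <;> simp [sigma3]
    calc 0 ≤ (u₀ ^ 2 / Complex.normSq z) ^ 2 * (s.sign * (sigma3 j j).re * (z.re * z.im)) :=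
          mul_nonneg (sq_nonneg _) hsign
      _ = s.sign * (sigma3 j.rev j.rev).re
          * ((-(u₀ : ℂ) ^ 2 / z).re * (-(u₀ : ℂ) ^ 2 / z).im) := by
        rw [neg_sq_div_re_mul_im, sigma3_rev]
        ring

theorem IsJostColumn.neg_sq_div (hu₀ : u₀ ≠ 0) (hv : ‖uInf s‖ = u₀) (hz : z ≠ 0)
    {f : ℝ → Fin 2 → ℂ} (hf : IsJostColumn α u₀ uInf u s t (-(u₀ : ℂ) ^ 2 / z) j.rev f) :
    IsJostColumn α u₀ uInf u s t z j (eigY (uInf s) z j.rev j • f) where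
  lax x := by
    have scaled := (hf.lax x).const_smul (eigY (uInf s) z j.rev j)
    rwa [laxX, specK_neg_sq_div hu₀, ← laxX, ← Matrix.mulVec_smul] at scaled
  normalized := by
    have scaled := hf.normalized.const_smul (eigY (uInf s) z j.rev j)
    rw [eigY_smul_col_neg_sq_div hu₀ hv hz] at scaled
    refine scaled.congr fun x => ?_
    rw [phase_neg_sq_div hu₀, expISigma3_neg_rev, smul_comm, Pi.smul_apply]

theorem IsJost.modifiedJost_neg_sq_div (hφ : IsJost α u₀ uInf u s φ) (hα : 0 < α) (hu₀ : u₀ ≠ 0)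
    (h : HasBackground u₀ uInf fun x => u x t) (hz : z ∈ jostDomain u₀ s j) (i : Fin 2) (x : ℝ) :
    modifiedJost α u₀ φ x t z i j
      = eigY (uInf s) z j.rev j * modifiedJost α u₀ φ x t (-(u₀ : ℂ) ^ 2 / z) i j.rev := by
  have columns_eq := (existsUnique_isJostColumn hα h hz).unique (hφ j t z hz)
    ((hφ j.rev t _ (neg_sq_div_mem_jostDomain hu₀ hz)).neg_sq_div hu₀ (h.norm_eq s)
      (mem_jostDomain_iff.1 hz).1)
  have entries_eq : φ x t z i j
      = eigY (uInf s) z j.rev j * φ x t (-(u₀ : ℂ) ^ 2 / z) i j.rev :=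
    congrFun (congrFun columns_eq x) i
  rw [modifiedJost_apply, modifiedJost_apply, entries_eq, phase_neg_sq_div hu₀,
    expISigma3_neg_rev, mul_assoc]

theorem inv_smul_expISigma3_mul_sigma3_mul_potQ (a v z : ℂ) (i j : Fin 2) :
    (z⁻¹ • (expISigma3 a * sigma3 * potQ v)) i j
      = eigY v z j.rev j * expISigma3 a i j.rev := by
  fin_cases i <;> fin_cases j <;> simp [eigY, expISigma3, sigma3, potQ] <;> ring

theorem tendsto_neg_sq_div (hu₀ : u₀ ≠ 0) (s : Side) (j : Fin 2) :
    Tendsto (fun z : ℂ => -(u₀ : ℂ) ^ 2 / z) (𝓝[≠] (0 : ℂ) ⊓ 𝓟 (jostDomain u₀ s j))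
      (Bornology.cobounded ℂ ⊓ 𝓟 (jostDomain u₀ s j.rev)) := by
  have hu : -(u₀ : ℂ) ^ 2 ≠ 0 := neg_ne_zero.2 (pow_ne_zero 2 (mod_cast hu₀))
  refine tendsto_inf.2 ⟨?_, tendsto_principal.2 ?_⟩
  · exact ((tendsto_mul_left_cobounded hu).comp tendsto_inv₀_nhdsNE_zero).mono_left inf_le_left
  · filter_upwards [mem_inf_of_right (mem_principal_self _)] with z hz
    exact neg_sq_div_mem_jostDomain hu₀ hz

theorem isBigO_eigY_rev_diag (v : ℂ) (j : Fin 2) (l : Filter ℂ) :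
    (fun z => eigY v z j.rev j) =O[l] fun z => z⁻¹ := by
  have proportional : (fun z => eigY v z j.rev j) = fun z => (sigma3 * potQ v) j.rev j * z⁻¹ := by
    funext z
    fin_cases j <;> simp [eigY, mul_comm]
  rw [proportional]
  exact (isBigO_refl _ l).const_mul_left _

theorem isBigO_modifiedJost_sub_zero (hα : 0 < α) (hu₀ : u₀ ≠ 0)
    (h : HasBackground u₀ uInf fun x => u x t) (hφ : IsJost α u₀ uInf u s φ) (i j : Fin 2)
    (x : ℝ) :
    (fun z => modifiedJost α u₀ φ x t z i j
        - (z⁻¹ • (expISigma3 (nu α u₀ u s x t : ℂ) * sigma3 * potQ (uInf s))) i j)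
      =O[𝓝[≠] (0 : ℂ) ⊓ 𝓟 (jostDomain u₀ s j)] fun _ => (1 : ℂ) := by
  have pulled_back := (isBigO_modifiedJost_sub hα h hφ i j.rev x).comp_tendsto
    (tendsto_neg_sq_div hu₀ s j)
  have product := (isBigO_eigY_rev_diag (uInf s) j _).mul pulled_back
  have bound_eq : (fun z : ℂ => z⁻¹ * (-(u₀ : ℂ) ^ 2 / z)⁻¹)
      =ᶠ[𝓝[≠] (0 : ℂ) ⊓ 𝓟 (jostDomain u₀ s j)] fun _ => (-(u₀ : ℂ) ^ 2)⁻¹ := by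
    filter_upwards [mem_inf_of_right (mem_principal_self _)] with z hz
    rw [inv_div, ← mul_div_assoc, inv_mul_cancel₀ (mem_jostDomain_iff.1 hz).1, one_div]
  refine (product.congr' ?_ bound_eq).trans (isBigO_const_one ℂ _ _)
  filter_upwards [mem_inf_of_right (mem_principal_self _)] with z hz
  rw [hφ.modifiedJost_neg_sq_div hα hu₀ h hz, inv_smul_expISigma3_mul_sigma3_mul_potQ, ← mul_sub]
  rfl

end Symmetry

end MNLS

end

theorem mainTheorem5 (α u₀ : ℝ) (hα : 0 < α) (hu₀ : 0 < u₀)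
    (uInf : MNLS.Side → ℂ) (huInf : ∀ s, ‖uInf s‖ = u₀)
    (u : ℝ → ℝ → ℂ)
    (hdiff : ∀ t, Differentiable ℝ (fun x => u x t))
    (hlim : ∀ s t, Tendsto (fun x => u x t) (MNLS.Side.atEnd s) (𝓝 (uInf s)))
    (hint : ∀ s t, IntegrableOn (fun x => u x t - uInf s) (MNLS.Side.halfLine s))
    (hderiv : ∀ t, Integrable (deriv (fun x => u x t))) :
    -- the Jost solutions exist and are unique, column by column
    (∀ (s : MNLS.Side) (j : Fin 2) (t : ℝ), ∀ z ∈ MNLS.jostDomain u₀ s j,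
      ∃! f : ℝ → Fin 2 → ℂ, MNLS.IsJostColumn α u₀ uInf u s t z j f) ∧
    -- the integrals in `ν_±` converge
    (∀ x t : ℝ, IntegrableOn (fun y => u₀ ^ 2 - ‖u y t‖ ^ 2) (Set.Iic x) ∧
      IntegrableOn (fun y => u₀ ^ 2 - ‖u y t‖ ^ 2) (Set.Ici x)) ∧
    ∀ (s : MNLS.Side) (φ : ℝ → ℝ → ℂ → Matrix (Fin 2) (Fin 2) ℂ),
      MNLS.IsJost α u₀ uInf u s φ → ∀ x t : ℝ,
      -- `z → ∞`, entry by entry, in the region of the column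
      (∀ i j : Fin 2,
        (fun z : ℂ => MNLS.modifiedJost α u₀ φ x t z i j
            - MNLS.expISigma3 (MNLS.nu α u₀ u s x t : ℂ) i j)
          =O[Bornology.cobounded ℂ ⊓ 𝓟 (MNLS.jostDomain u₀ s j)] (fun z : ℂ => z⁻¹)) ∧
      -- `z → 0`, entry by entry, in the region of the column
      (∀ i j : Fin 2,
        (fun z : ℂ => MNLS.modifiedJost α u₀ φ x t z i j
            - (z⁻¹ • (MNLS.expISigma3 (MNLS.nu α u₀ u s x t : ℂ)
                * MNLS.sigma3 * MNLS.potQ (uInf s))) i j)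
          =O[𝓝[≠] (0 : ℂ) ⊓ 𝓟 (MNLS.jostDomain u₀ s j)] (fun _ : ℂ => (1 : ℂ))) ∧
      -- recovery of the potential
      Tendsto (fun z : ℂ => (MNLS.expISigma3 (MNLS.nu α u₀ u s x t : ℂ)
          * (z • MNLS.modifiedJost α u₀ φ x t z)) 0 1)
        (Bornology.cobounded ℂ ⊓ 𝓟 (MNLS.jostDomain u₀ s 1)) (𝓝 (u x t)) := by
  have hbg : ∀ t, MNLS.HasBackground u₀ uInf fun x => u x t := fun t =>
    ⟨huInf, hdiff t, fun s => hlim s t, fun s => hint s t, hderiv t⟩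
  refine ⟨fun s j t z hz => MNLS.existsUnique_isJostColumn hα (hbg t) hz,
    fun x t => (hbg t).integrableOn_defect x, fun s φ hφ x t => ⟨fun i j => ?_, fun i j => ?_, ?_⟩⟩
  · exact MNLS.isBigO_modifiedJost_sub hα (hbg t) hφ i j x
  · exact MNLS.isBigO_modifiedJost_sub_zero hα hu₀.ne' (hbg t) hφ i j x
  · exact MNLS.tendsto_expISigma3_mul_modifiedJost hα (hbg t) hφ x
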